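/- Let $m\ge 1$, let $[m]=\{1,\dots,m\}$, and let $K$ be an abstract simplicial complex on $[m]$, i.e. a family of subsets of $[m]$ that contains $\emptyset$ and is closed under passing to subsets (it is allowed, but not required, that every $\{i\}$ belongs to $K$). Let $$\mathcal Z_K=\bigcup_{\sigma\in K}\{z\in\mathbb C^m : |z_i|\le 1 \text{ for } i\in\sigma,\ |z_i|=1 \text{ for } i\notin\sigma\},$$ $$\mathbb R\mathcal Z_K=\bigcup_{\sigma\in K}\{x\in\mathbb R^m : |x_i|\le 1 \text{ for } i\in\sigma,\ |x_i|=1 \text{ for } i\notin\sigma\}$$ be the moment-angle complex and the real moment-angle complex of $K$. The torus $T^m=(S^1)^m$ acts on $\mathcal Z_K$, and the $2$-torus $(\mathbb Z_2)^m=\{\pm1\}^m$ acts on $\mathbb R\mathcal Z_K$, by coordinatewise multiplication. Let $\mathbf k$ be any field and $r\ge 0$ an integer. (a) If a subtorus $H\subseteq T^m$ of rank $r$ (a subgroup isomorphic, as a topological group, to $T^r$) acts freely on $\mathcal Z_K$ by restriction of the $T^m$-action, then $\sum_i\dim_{\mathbf k}H^i(\mathcal Z_K;\mathbf k)\ge 2^r$.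 (b) If a subgroup $H\subseteq(\mathbb Z_2)^m$ of rank $r$ (isomorphic to $(\mathbb Z_2)^r$) acts freely on $\mathbb R\mathcal Z_K$ by restriction of the $(\mathbb Z_2)^m$-action, then $\sum_i\dim_{\mathbf k}H^i(\mathbb R\mathcal Z_K;\mathbf k)\ge 2^r$. In particular, taking $\mathbf k$ of characteristic $0$ in (a) and of characteristic $2$ in (b), the Halperin–Carlsson conjecture holds for $\mathcal Z_K$ and $\mathbb R\mathcal Z_K$ under the restriction of these natural actions. -/

import Mathlib

universe u

noncomputable section

/-- For a pair `W ⊆ X` of subsets of `E`, the subspace `K(X, W) = ⋃_{σ ∈ K} B_σ(X, W)` of `E^m`,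
where `B_σ(X, W)` is the product with `i`-th factor `X` for `i ∈ σ` and `W` for `i ∉ σ`.
Faces in `PreAbstractSimplicialComplex` are nonempty by convention, so the empty simplex, which
belongs to every abstract simplicial complex, is put back by hand. Not every `{i}` has to be
a face. -/
def polyhedralProduct {m : ℕ} {E : Type*} (K : PreAbstractSimplicialComplex (Fin m))
    (X W : Set E) : Set (Fin m → E) :=
  ⋃ σ ∈ insert ∅ K.faces, {z | ∀ i, (i ∈ σ → z i ∈ X) ∧ (i ∉ σ → z i ∈ W)}

/-- The moment-angle complex `𝒵_K = K(D², S¹) ⊆ ℂ^m`. -/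
def momentAngle {m : ℕ} (K : PreAbstractSimplicialComplex (Fin m)) : Set (Fin m → ℂ) :=
  polyhedralProduct K (Metric.closedBall 0 1) (Metric.sphere 0 1)

/-- The real moment-angle complex `ℝ𝒵_K = K(D¹, S⁰) ⊆ ℝ^m`. -/
def realMomentAngle {m : ℕ} (K : PreAbstractSimplicialComplex (Fin m)) : Set (Fin m → ℝ) :=
  polyhedralProduct K (Metric.closedBall 0 1) (Metric.sphere 0 1)

theorem smul_mem_polyhedralProduct {m : ℕ} {E G : Type*} [SMul G E]
    (K : PreAbstractSimplicialComplex (Fin m)) {X W : Set E}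
    (hX : ∀ (g : G), ∀ x ∈ X, g • x ∈ X) (hW : ∀ (g : G), ∀ x ∈ W, g • x ∈ W)
    (g : Fin m → G) {z : Fin m → E} (hz : z ∈ polyhedralProduct K X W) :
    (fun i => g i • z i) ∈ polyhedralProduct K X W := by
  simp only [polyhedralProduct, Set.mem_iUnion, Set.mem_ofPred_eq] at hz ⊢
  obtain ⟨σ, hσ, h⟩ := hz
  exact ⟨σ, hσ, fun i => ⟨fun hi => hX _ _ ((h i).1 hi), fun hi => hW _ _ ((h i).2 hi)⟩⟩

theorem norm_intUnits_smul (g : ℤˣ) (x : ℝ) : ‖g • x‖ = ‖x‖ := by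
  rcases Int.units_eq_one_or g with rfl | rfl <;> simp [Units.smul_def]

/-- The natural action of the torus `T^m = (S¹)^m` on `𝒵_K`:
`(g₁, …, g_m) • (z₁, …, z_m) = (g₁ z₁, …, g_m z_m)`. -/
instance torusAction {m : ℕ} (K : PreAbstractSimplicialComplex (Fin m)) :
    MulAction (Fin m → Circle) (momentAngle K) where
  smul g z := ⟨fun i => g i • z.1 i, smul_mem_polyhedralProduct K
    (by simp [Circle.norm_smul]) (by simp [Circle.norm_smul]) g z.2⟩
  one_smul z := Subtype.ext (funext fun i => one_smul Circle (z.1 i))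
  mul_smul g h z := Subtype.ext (funext fun i => mul_smul (g i) (h i) (z.1 i))

/-- The natural action of the 2-torus `(ℤ₂)^m = {-1, 1}^m` on `ℝ𝒵_K`:
`(g₁, …, g_m) • (x₁, …, x_m) = (g₁ x₁, …, g_m x_m)`. -/
instance twoTorusAction {m : ℕ} (K : PreAbstractSimplicialComplex (Fin m)) :
    MulAction (Fin m → ℤˣ) (realMomentAngle K) where
  smul g x := ⟨fun i => g i • x.1 i, smul_mem_polyhedralProduct K
    (fun g y hy => by rw [mem_closedBall_zero_iff] at hy ⊢; rwa [norm_intUnits_smul])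
    (fun g y hy => by rw [mem_sphere_zero_iff_norm] at hy ⊢; rwa [norm_intUnits_smul]) g x.2⟩
  one_smul x := Subtype.ext (funext fun i => one_smul ℤˣ (x.1 i))
  mul_smul g h x := Subtype.ext (funext fun i => mul_smul (g i) (h i) (x.1 i))

/-- Singular cohomology `Hⁿ(X; k)`: the cohomology of the cochain complex
`Hom_k(C_•(X; k), k)`, where `C_•(X; k)` is the singular chain complex. -/
def singularCohomology (k : Type u) [Field k] (X : Type) [TopologicalSpace X] (n : ℕ) :
    ModuleCat.{u} k :=
  ((((AlgebraicTopology.singularChainComplexFunctor (ModuleCat.{u} k)).obj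
    (ModuleCat.of k k)).obj (TopCat.of X)).linearYonedaObj k (ModuleCat.of k k)).homology n

/-- The total dimension `∑ₙ dim_k Hⁿ(X; k)`, as a cardinal number. -/
def totalCohomologyDim (k : Type u) [Field k] (X : Type) [TopologicalSpace X] : Cardinal.{u} :=
  Cardinal.sum fun n : ℕ => Module.rank k (singularCohomology k X n)

end

noncomputable section

/-! Choose an inclusion-maximal face `σ` of `K`, possibly empty. Two estimates meet at `m - |σ|`.

Rank of `H`: the point with coordinates 0 on `σ` and 1 elsewhere is fixed by every group element
that is trivial off `σ`. Freeness therefore makes the projection of `H` to the coordinates off `σ`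
injective, and counting elements of order at most 2 gives `r ≤ m - |σ|` (`le_card_of_injective`).

Homology: in the real case, fix a coordinate `v`. The space `Z` consists of two copies of `D = {x v
= 1}` joined by a cylinder over `L = {x v = 0}`, and folding retracts `Z` onto `D`. By
Mayer-Vietoris, `H_{n+1}(Z)` contains independent copies of `H_{n+1}(D)` and of the kernel of
`H_n(L) → H_n(D)`. Rank-nullity and summation over `n` show that `L` has at most the total homology
of `Z` (`OpenDouble.totalHomologyDim_le`). Setting the coordinates in `σ` to 0 one after another
leaves, by maximality, exactly `2^(m - |σ|)` isolated points, which `H_0` counts.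

The complex case reduces to the real one: a homeomorphism from the disc to the square that matches
the boundaries turns `𝒵_K` into a real polyhedral product on `2m` vertices, which has a maximal face
with complement of size `m - |σ|`.

Cohomology enters only through `dim H_n ≤ dim H^n`, valid over every field and in infinite
dimension. The singular theory required (prisms, barycentric subdivision, small chains) is developed
on concrete chains. -/

theorem Fin.succ_succAbove_succAbove_of_le {n : ℕ} {i j : Fin (n + 2)} (h : i ≤ j) (x : Fin (n + 1)) :
    j.succ.succAbove (i.succAbove x) = i.castSucc.succAbove (j.succAbove x) := by
  have := congrArg (fun f => f.toOrderHom x) (SimplexCategory.δ_comp_δ h)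
  simpa [SimplexCategory.δ] using this

/-! ### Alternating sums of face maps -/

section AltBoundary

variable (k : Type u) [Field k]

/-- The alternating sum `∑ i, (-1)^i d_i` of the maps on free modules induced by face maps. -/
def altBoundary {A B : Type*} {n : ℕ} (d : Fin (n + 2) → A → B) : (A →₀ k) →ₗ[k] (B →₀ k) :=
  ∑ i : Fin (n + 2), (-1 : k) ^ (i : ℕ) • Finsupp.lmapDomain k k (d i)

variable {k}

theorem altBoundary_apply {A B : Type*} {n : ℕ} (d : Fin (n + 2) → A → B) (c : A →₀ k) :
    altBoundary k d c = ∑ i : Fin (n + 2), (-1 : k) ^ (i : ℕ) • Finsupp.mapDomain (d i) c := by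
  simp [altBoundary, LinearMap.sum_apply, Finsupp.lmapDomain_apply]

theorem altBoundary_single {A B : Type*} {n : ℕ} (d : Fin (n + 2) → A → B) (a : A) (x : k) :
    altBoundary k d (Finsupp.single a x) =
      ∑ i : Fin (n + 2), Finsupp.single (d i a) ((-1 : k) ^ (i : ℕ) * x) := by
  simp [altBoundary_apply, Finsupp.mapDomain_single]

theorem altBoundary_mapDomain {A B A' B' : Type*} {n : ℕ} (d : Fin (n + 2) → A → B)
    (d' : Fin (n + 2) → A' → B') (f : A → A') (g : B → B') (h : ∀ i a, d' i (f a) = g (d i a))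
    (c : A →₀ k) :
    altBoundary k d' (Finsupp.mapDomain f c) = Finsupp.mapDomain g (altBoundary k d c) := by
  induction c using Finsupp.induction_linear with
  | zero => simp
  | add a b ha hb => simp only [Finsupp.mapDomain_add, map_add, ha, hb]
  | single a x =>
    rw [Finsupp.mapDomain_single, altBoundary_single, altBoundary_single,
      ← Finsupp.lmapDomain_apply k k, map_sum]
    exact Finset.sum_congr rfl fun i _ => by
      rw [h, Finsupp.lmapDomain_apply, Finsupp.mapDomain_single]

/-- The double sum splits into the pairs with `j < i` and those with `i ≤ j`; the face identity
matches the two halves with opposite signs. -/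
theorem altBoundary_altBoundary {A B C : Type*} {n : ℕ} (d : Fin (n + 3) → A → B)
    (d' : Fin (n + 2) → B → C)
    (h : ∀ (i j : Fin (n + 2)) (a : A), i ≤ j → d' i (d j.succ a) = d' j (d i.castSucc a))
    (c : A →₀ k) : altBoundary k d' (altBoundary k d c) = 0 := by
  induction c using Finsupp.induction_linear with
  | zero => simp
  | add a b ha hb => simp only [map_add, ha, hb, add_zero]
  | single a x =>
    simp only [altBoundary_single, map_sum]
    rw [← Finset.sum_product']
    let P := Fin (n + 3) × Fin (n + 2)
    let S : Finset P := {p : P | (p.2 : ℕ) < (p.1 : ℕ)}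
    rw [Finset.univ_product_univ, ← Finset.sum_add_sum_compl S, ← eq_neg_iff_add_eq_zero,
      ← Finset.sum_neg_distrib]
    -- Omitting `i` and then `j < i` amounts to omitting `j` and then `i - 1`.
    let φ : ∀ p : P, p ∈ S → P := fun p hp =>
      (p.2.castSucc, p.1.pred (by
        intro h0; simp [S, h0] at hp))
    refine Finset.sum_bij φ ?_ ?_ ?_ ?_
    · intro p hp
      simp only [S, φ, Finset.mem_filter, Finset.mem_univ, true_and, Finset.mem_compl] at hp ⊢
      simp; omega
    · rintro ⟨i, j⟩ hp ⟨i', j'⟩ hp' hh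
      have h1 := Fin.castSucc_inj.1 (congrArg Prod.fst hh)
      have h2 : i = i' := by
        have h3 := congrArg (fun p => p.2.val) hh
        simp only [φ, Fin.val_pred] at h3
        simp [S] at hp hp'
        omega
      exact Prod.ext h2 h1
    · rintro ⟨i, j⟩ hp
      simp only [S, Finset.mem_filter, Finset.mem_univ, true_and, Finset.mem_compl, not_lt] at hp
      refine ⟨(j.succ, ⟨i, by omega⟩), ?_, ?_⟩
      · simp [S]; omega
      · simp [φ]
    · rintro ⟨i, j⟩ hp
      simp only [S, Finset.mem_filter, Finset.mem_univ, true_and] at hp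
      have hi : i ≠ 0 := by intro h0; simp [h0] at hp
      obtain ⟨i, rfl⟩ := Fin.exists_succ_eq.2 hi
      have := h j i a (by simp at hp; exact Fin.le_def.2 (by omega))
      simp only [φ, Fin.pred_succ, this, ← Finsupp.single_neg]
      congr 1
      simp [pow_succ]; ring

end AltBoundary

/-! ### Singular chains and singular homology -/

section SingularChains

variable (k : Type u) [Field k]

/-- The `i`-th face inclusion of topological simplices. -/
def simplexFace {n : ℕ} (i : Fin (n + 2)) :
    C(stdSimplex ℝ (Fin (n + 1)), stdSimplex ℝ (Fin (n + 2))) :=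
  ⟨stdSimplex.map i.succAbove, stdSimplex.continuous_map _⟩

/-- Singular `n`-chains of `X` as finitely supported functions on singular simplices. -/
abbrev SingChain (X : Type*) [TopologicalSpace X] (n : ℕ) :=
  C(stdSimplex ℝ (Fin (n + 1)), X) →₀ k

/-- The singular boundary map. -/
def singBoundary (X : Type*) [TopologicalSpace X] (n : ℕ) :
    SingChain k X (n + 1) →ₗ[k] SingChain k X n :=
  altBoundary k fun i σ => σ.comp (simplexFace i)

variable {k}

theorem simplexFace_comp {n : ℕ} {i j : Fin (n + 2)} (h : i ≤ j) :
    (simplexFace j.succ).comp (simplexFace i) = (simplexFace i.castSucc).comp (simplexFace j) := by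
  ext1 w
  simp only [simplexFace, ContinuousMap.comp_apply, ContinuousMap.coe_mk,
    stdSimplex.map_comp_apply]
  congr 1
  funext x
  exact Fin.succ_succAbove_succAbove_of_le h x

theorem singBoundary_singBoundary {X : Type*} [TopologicalSpace X] {n : ℕ}
    (c : SingChain k X (n + 2)) : singBoundary k X n (singBoundary k X (n + 1) c) = 0 := by
  refine altBoundary_altBoundary _ _ (fun i j σ hij => ?_) c
  rw [ContinuousMap.comp_assoc, ContinuousMap.comp_assoc, simplexFace_comp hij]

variable (k) in
/-- The map on singular chains induced by a continuous map. -/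
def singMap {X Y : Type*} [TopologicalSpace X] [TopologicalSpace Y] (f : C(X, Y)) (n : ℕ) :
    SingChain k X n →ₗ[k] SingChain k Y n :=
  Finsupp.lmapDomain k k fun σ => f.comp σ

section

variable {X Y Z : Type*} [TopologicalSpace X] [TopologicalSpace Y] [TopologicalSpace Z] {n : ℕ}

@[simp]
theorem singMap_single (f : C(X, Y)) (σ : C(stdSimplex ℝ (Fin (n + 1)), X)) (x : k) :
    singMap k f n (Finsupp.single σ x) = Finsupp.single (f.comp σ) x := by
  simp [singMap, Finsupp.mapDomain_single]

theorem singMap_comp (g : C(Y, Z)) (f : C(X, Y)) (c : SingChain k X n) :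
    singMap k g n (singMap k f n c) = singMap k (g.comp f) n c := by
  simp only [singMap, Finsupp.lmapDomain_apply, ← Finsupp.mapDomain_comp]
  rfl

theorem singMap_id (c : SingChain k X n) : singMap k (ContinuousMap.id X) n c = c := by
  simp only [singMap, Finsupp.lmapDomain_apply]
  exact Finsupp.mapDomain_id

theorem singBoundary_singMap (f : C(X, Y)) (c : SingChain k X (n + 1)) :
    singBoundary k Y n (singMap k f (n + 1) c) = singMap k f n (singBoundary k X n c) := by
  simp only [singMap, singBoundary, Finsupp.lmapDomain_apply]
  exact altBoundary_mapDomain _ _ _ _ (fun i σ => ContinuousMap.comp_assoc f σ _) c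

theorem singMap_injective {f : C(X, Y)} (hf : Function.Injective f) :
    Function.Injective (singMap k f n) :=
  Finsupp.mapDomain_injective fun σ τ h => by
    ext1 x
    exact hf (DFunLike.congr_fun h x)

end

section Homology

variable (k) (X : Type) [TopologicalSpace X]

/-- Singular cycles. -/
def singCycles : (n : ℕ) → Submodule k (SingChain k X n)
  | 0 => ⊤
  | n + 1 => LinearMap.ker (singBoundary k X n)

/-- Singular boundaries. -/
def singBoundaries (n : ℕ) : Submodule k (SingChain k X n) :=
  LinearMap.range (singBoundary k X n)

/-- Singular homology as a quotient of cycles by boundaries. -/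
def SingHomology (n : ℕ) : Type u :=
  (singCycles k X n).map (singBoundaries k X n).mkQ

instance (n : ℕ) : AddCommGroup (SingHomology k X n) :=
  inferInstanceAs (AddCommGroup ((singCycles k X n).map (singBoundaries k X n).mkQ))

instance (n : ℕ) : Module k (SingHomology k X n) :=
  inferInstanceAs (Module k ((singCycles k X n).map (singBoundaries k X n).mkQ))

/-- The homology class of a cycle. -/
def singClass (n : ℕ) : singCycles k X n →ₗ[k] SingHomology k X n :=
  show singCycles k X n →ₗ[k] (singCycles k X n).map (singBoundaries k X n).mkQ from
    (singBoundaries k X n).mkQ.submoduleMap (singCycles k X n)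

/-- The total dimension of singular homology. -/
def totalHomologyDim : Cardinal.{u} :=
  Cardinal.sum fun n : ℕ => Module.rank k (SingHomology k X n)

variable {X} {Y : Type} [TopologicalSpace Y]

theorem singMap_mem_singCycles (f : C(X, Y)) {n : ℕ} {c : SingChain k X n}
    (hc : c ∈ singCycles k X n) : singMap k f n c ∈ singCycles k Y n := by
  cases n with
  | zero => trivial
  | succ n =>
    simp only [singCycles, LinearMap.mem_ker] at hc ⊢
    rw [singBoundary_singMap, hc, map_zero]

theorem singMap_mem_singBoundaries (f : C(X, Y)) {n : ℕ} {c : SingChain k X n}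
    (hc : c ∈ singBoundaries k X n) : singMap k f n c ∈ singBoundaries k Y n := by
  obtain ⟨b, rfl⟩ := hc
  exact ⟨_, singBoundary_singMap f b⟩

/-- The map on singular cycles induced by a continuous map. -/
def singCyclesMap (f : C(X, Y)) (n : ℕ) : singCycles k X n →ₗ[k] singCycles k Y n :=
  (singMap k f n).restrict fun _ hc => singMap_mem_singCycles k f hc

/-- The map on singular homology induced by a continuous map. -/
def singHomologyMap (f : C(X, Y)) (n : ℕ) : SingHomology k X n →ₗ[k] SingHomology k Y n :=
  show (singCycles k X n).map (singBoundaries k X n).mkQ →ₗ[k]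
      (singCycles k Y n).map (singBoundaries k Y n).mkQ from
  (Submodule.mapQ (singBoundaries k X n) (singBoundaries k Y n) (singMap k f n) fun _ hc =>
    singMap_mem_singBoundaries k f hc).restrict <| by
    rintro _ ⟨c, hc, rfl⟩
    exact ⟨singMap k f n c, singMap_mem_singCycles k f hc, rfl⟩

variable {k}

theorem singClass_surjective (n : ℕ) : Function.Surjective (singClass k X n) :=
  (singBoundaries k X n).mkQ.submoduleMap_surjective (singCycles k X n)

theorem singClass_eq_zero_iff {n : ℕ} (c : singCycles k X n) :
    singClass k X n c = 0 ↔ (c : SingChain k X n) ∈ singBoundaries k X n := by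
  rw [← Submodule.Quotient.mk_eq_zero]
  exact Subtype.ext_iff

theorem singHomologyMap_singClass (f : C(X, Y)) {n : ℕ} (c : singCycles k X n) :
    singHomologyMap k f n (singClass k X n c) = singClass k Y n (singCyclesMap k f n c) :=
  rfl

variable (k)

/-- The image of `(f, g)` in `M × N` projects onto `N` and embeds in `M`. This bounds ranks without
constructing a map between `M` and `N`. -/
theorem rank_le_of_surjective_of_ker_le {P M N : Type u} [AddCommMonoid P] [AddCommGroup M]
    [AddCommGroup N] [Module k P] [Module k M] [Module k N] (f : P →ₗ[k] M) (g : P →ₗ[k] N)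
    (hg : Function.Surjective g) (h : ∀ x, f x = 0 → g x = 0) :
    Module.rank k N ≤ Module.rank k M := by
  let R := LinearMap.range (f.prod g)
  have h1 : Function.Surjective (LinearMap.snd k M N ∘ₗ R.subtype) := fun y => by
    obtain ⟨x, rfl⟩ := hg y
    exact ⟨⟨(f x, g x), x, rfl⟩, rfl⟩
  have h2 : Function.Injective (LinearMap.fst k M N ∘ₗ R.subtype) := by
    rw [← LinearMap.ker_eq_bot, LinearMap.ker_eq_bot']
    rintro ⟨_, x, rfl⟩ hx
    exact Subtype.ext (Prod.ext hx (h x hx))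
  exact (LinearMap.rank_le_of_surjective _ h1).trans (LinearMap.rank_le_of_injective _ h2)

/-- Surjections of vector spaces split. This makes the choice of bounding chains linear. -/
theorem exists_lift_of_range_le {U V W : Type*} [AddCommMonoid U] [AddCommGroup V]
    [AddCommGroup W] [Module k U] [Module k V] [Module k W] (f : V →ₗ[k] W) (h : U →ₗ[k] W)
    (hh : ∀ x, h x ∈ LinearMap.range f) : ∃ t : U →ₗ[k] V, ∀ x, f (t x) = h x := by
  obtain ⟨s, hs⟩ := f.rangeRestrict.exists_rightInverse_of_surjective
    (LinearMap.range_rangeRestrict f)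
  refine ⟨s ∘ₗ h.codRestrict _ hh, fun x => ?_⟩
  exact congrArg Subtype.val (LinearMap.congr_fun hs (h.codRestrict _ hh x))

theorem rank_singHomology_le_of_retract (f : C(X, Y)) (g : C(Y, X))
    (h : g.comp f = ContinuousMap.id X) (n : ℕ) :
    Module.rank k (SingHomology k X n) ≤ Module.rank k (SingHomology k Y n) := by
  refine LinearMap.rank_le_of_surjective (singHomologyMap k g n) fun y => ?_
  obtain ⟨y, rfl⟩ := singClass_surjective n y
  refine ⟨singClass k Y n (singCyclesMap k f n y), ?_⟩
  rw [singHomologyMap_singClass]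
  congr 1
  ext1
  change singMap k g n (singMap k f n y) = y
  rw [singMap_comp, h, singMap_id]

theorem totalHomologyDim_le_of_retract (f : C(X, Y)) (g : C(Y, X))
    (h : g.comp f = ContinuousMap.id X) : totalHomologyDim k X ≤ totalHomologyDim k Y :=
  Cardinal.sum_le_sum _ _ (rank_singHomology_le_of_retract k f g h)

end Homology

end SingularChains

/-! ### Comparison of singular homology with singular cohomology -/

section SingularCohomology

open CategoryTheory Limits AlgebraicTopology Simplicial

variable {k : Type u} [Field k]

/-- The value `g p` depends only on the class of the cocycle `f p`, so `N` is a subquotient of the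
homology. -/
theorem CategoryTheory.ShortComplex.rank_le_rank_homology (S : ShortComplex (ModuleCat.{u} k))
    {P N : Type u} [AddCommGroup P] [AddCommGroup N] [Module k P] [Module k N]
    (f : P →ₗ[k] S.X₂) (g : P →ₗ[k] N) (hg : Function.Surjective g) (hf : ∀ p, S.g (f p) = 0)
    (h : ∀ p y, S.f y = f p → g p = 0) : Module.rank k N ≤ Module.rank k S.homology := by
  rw [S.moduleCatHomologyIso.toLinearEquiv.rank_eq]
  change _ ≤ Module.rank k (LinearMap.ker S.g.hom ⧸ LinearMap.range S.moduleCatToCycles)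
  refine rank_le_of_surjective_of_ker_le k
    ((LinearMap.range S.moduleCatToCycles).mkQ ∘ₗ f.codRestrict (LinearMap.ker S.g.hom) hf) g hg ?_
  intro p hp
  rw [LinearMap.comp_apply, Submodule.mkQ_apply,
    Submodule.Quotient.mk_eq_zero] at hp
  obtain ⟨y, hy⟩ := hp
  exact h p y (congrArg Subtype.val hy)

theorem CochainComplex.rank_le_rank_homology (D : CochainComplex (ModuleCat.{u} k) ℕ) (n : ℕ)
    {P N : Type u} [AddCommGroup P] [AddCommGroup N] [Module k P] [Module k N]
    (f : P →ₗ[k] D.X n) (g : P →ₗ[k] N) (hg : Function.Surjective g)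
    (hf : ∀ m p, D.d n m (f p) = 0)
    (h : ∀ p m y, D.d m n y = f p → g p = 0) : Module.rank k N ≤ Module.rank k (D.homology n) :=
  (D.sc n).rank_le_rank_homology f g hg (hf _) (fun p y => h p _ y)

/-- The coordinate functionals of a basis are independent. In infinite dimension the inequality is
strict. -/
theorem rank_le_rank_dual (V : Type u) [AddCommGroup V] [Module k V] :
    Module.rank k V ≤ Module.rank k (Module.Dual k V) := by
  classical
  exact LinearMap.rank_le_of_injective (Module.Basis.ofVectorSpace k V).toDual
    (Module.Basis.toDual_injective _)

variable (k) (X : Type) [TopologicalSpace X]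

/-- The categorical singular chain complex with coefficients in `k`. -/
abbrev singComplex : ChainComplex (ModuleCat.{u} k) ℕ :=
  (TopCat.toSSet.obj (TopCat.of X)).chainComplex (ModuleCat.of k k)

variable {X} in
/-- The inclusion of the summand of a singular simplex. -/
def singComplexι {n : ℕ} (σ : C(stdSimplex ℝ (Fin (n + 1)), X)) :
    ModuleCat.of k k ⟶ (singComplex k X).X n :=
  (TopCat.toSSet.obj (TopCat.of X)).ιChainComplex
    (((TopCat.of X).toSSetObjEquiv (.op ⦋n⦌)).symm σ)

/-- The comparison map from concrete chains to categorical chains. -/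
def singChainToComplex (n : ℕ) : SingChain k X n →ₗ[k] (singComplex k X).X n :=
  Finsupp.linearCombination k fun σ => (singComplexι k σ).hom (1 : k)

/-- The comparison map from categorical chains to concrete chains. -/
def complexToSingChain (n : ℕ) : (singComplex k X).X n →ₗ[k] SingChain k X n :=
  (((TopCat.toSSet.obj (TopCat.of X)).isColimitChainComplexXCofan (ModuleCat.of k k) n).desc
    (Cofan.mk (ModuleCat.of k (SingChain k X n)) fun x => ModuleCat.ofHom
      (Finsupp.lsingle ((TopCat.of X).toSSetObjEquiv (.op ⦋n⦌) x)))).hom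

variable {k X}

theorem singComplexι_complexToSingChain {n : ℕ} (σ : C(stdSimplex ℝ (Fin (n + 1)), X)) (a : k) :
    complexToSingChain k X n ((singComplexι k σ).hom a) = Finsupp.single σ a := by
  have := ((TopCat.toSSet.obj (TopCat.of X)).isColimitChainComplexXCofan (ModuleCat.of k k) n).fac
    (Cofan.mk (ModuleCat.of k (SingChain k X n)) fun x => ModuleCat.ofHom
      (Finsupp.lsingle ((TopCat.of X).toSSetObjEquiv (.op ⦋n⦌) x)))
      ⟨((TopCat.of X).toSSetObjEquiv (.op ⦋n⦌)).symm σ⟩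
  have h2 := congrArg (fun f => f.hom a) this
  refine Eq.trans h2 ?_
  change Finsupp.single (((TopCat.of X).toSSetObjEquiv (.op ⦋n⦌))
    (((TopCat.of X).toSSetObjEquiv (.op ⦋n⦌)).symm σ)) a = _
  rw [Equiv.apply_symm_apply]

theorem complexToSingChain_singChainToComplex {n : ℕ} (c : SingChain k X n) :
    complexToSingChain k X n (singChainToComplex k X n c) = c := by
  induction c using Finsupp.induction_linear with
  | zero => simp
  | add a b ha hb => simp only [map_add, ha, hb]
  | single σ a =>
    rw [singChainToComplex, Finsupp.linearCombination_single, map_smul,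
      singComplexι_complexToSingChain]
    simp

theorem singChainToComplex_complexToSingChain {n : ℕ} (c : (singComplex k X).X n) :
    singChainToComplex k X n (complexToSingChain k X n c) = c := by
  have : ModuleCat.ofHom (singChainToComplex k X n ∘ₗ complexToSingChain k X n) =
      𝟙 ((singComplex k X).X n) := by
    refine SSet.chainComplex_hom_ext fun x => ?_
    obtain ⟨σ, rfl⟩ := ((TopCat.of X).toSSetObjEquiv (.op ⦋n⦌)).symm.surjective x
    ext
    change singChainToComplex k X n (complexToSingChain k X n ((singComplexι k σ).hom (1 : k))) =
      (singComplexι k σ).hom (1 : k)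
    rw [singComplexι_complexToSingChain, singChainToComplex, Finsupp.linearCombination_single,
      one_smul]
  exact congrArg (fun f => f.hom c) this

theorem d_singChainToComplex {n : ℕ} (c : SingChain k X (n + 1)) :
    (singComplex k X).d (n + 1) n (singChainToComplex k X (n + 1) c) =
      singChainToComplex k X n (singBoundary k X n c) := by
  induction c using Finsupp.induction_linear with
  | zero => simp
  | add a b ha hb => simp only [map_add, ha, hb]
  | single σ a =>
    have h := (TopCat.toSSet.obj (TopCat.of X)).ιChainComplex_d (R := ModuleCat.of k k)
      (((TopCat.of X).toSSetObjEquiv (.op ⦋n + 1⦌)).symm σ)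
    have h2 : (singComplex k X).d (n + 1) n ((singComplexι k σ).hom (1 : k)) =
        (∑ i : Fin (n + 2), (-1 : ℤ) ^ (i : ℕ) •
          singComplexι k (σ.comp (simplexFace i))).hom (1 : k) :=
      congrArg (fun f => f.hom (1 : k)) h
    rw [singBoundary, altBoundary_single, map_sum, singChainToComplex,
      Finsupp.linearCombination_single, map_smul, h2, ModuleCat.hom_sum, LinearMap.sum_apply,
      Finset.smul_sum]
    refine Finset.sum_congr rfl fun i _ => ?_
    rw [singChainToComplex, Finsupp.linearCombination_single, ModuleCat.hom_zsmul,
      LinearMap.smul_apply, ← Int.cast_smul_eq_zsmul k, smul_smul, mul_comm]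
    simp

theorem singComplex_d_apply {n : ℕ} (c : (singComplex k X).X (n + 1)) :
    (singComplex k X).d (n + 1) n c =
      singChainToComplex k X n (singBoundary k X n (complexToSingChain k X (n + 1) c)) := by
  rw [← d_singChainToComplex, singChainToComplex_complexToSingChain]

variable (k X)

/-- A functional on chains modulo boundaries is a cocycle, every functional on homology extends to
one, and coboundaries vanish on cycles. This is the surjection from cohomology to the dual of
homology; its injectivity plays no role. -/
theorem rank_singHomology_le (n : ℕ) :
    Module.rank k (SingHomology k X n) ≤ Module.rank k (singularCohomology k X n) := by
  refine (rank_le_rank_dual _).trans ?_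
  let f : Module.Dual k (SingChain k X n ⧸ singBoundaries k X n) →ₗ[k]
      ((singComplex k X).linearYonedaObj k (ModuleCat.of k k)).X n :=
    { toFun ψ := ModuleCat.ofHom (ψ ∘ₗ (singBoundaries k X n).mkQ ∘ₗ complexToSingChain k X n)
      map_add' _ _ := rfl
      map_smul' _ _ := rfl }
  refine CochainComplex.rank_le_rank_homology
    ((singComplex k X).linearYonedaObj k (ModuleCat.of k k)) n f
    (Submodule.dualRestrict ((singCycles k X n).map (singBoundaries k X n).mkQ)) Subspace.dualRestrict_surjective ?_ ?_
  · intro m ψ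
    change (singComplex k X).d m n ≫ ModuleCat.ofHom _ = 0
    by_cases hm : n + 1 = m
    · subst hm
      ext c
      change ψ ((singBoundaries k X n).mkQ (complexToSingChain k X n
        ((singComplex k X).d (n + 1) n c))) = 0
      rw [singComplex_d_apply, complexToSingChain_singChainToComplex, Submodule.mkQ_apply]
      have h0 := (Submodule.Quotient.mk_eq_zero (singBoundaries k X n)).2
        (LinearMap.mem_range_self (singBoundary k X n) (complexToSingChain k X (n + 1) c))
      exact (congrArg ψ h0).trans (map_zero ψ)
    · rw [(singComplex k X).shape m n hm]
      exact zero_comp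
  · intro ψ m y hy
    replace hy : (singComplex k X).d n m ≫ y = ModuleCat.ofHom _ := hy
    ext ⟨_, c, hc, rfl⟩
    have h1 : ψ ((singBoundaries k X n).mkQ c) = y.hom ((singComplex k X).d n m
        (singChainToComplex k X n c)) := by
      have := congrArg (fun g => g.hom (singChainToComplex k X n c)) hy
      refine Eq.trans ?_ this.symm
      change _ = ψ ((singBoundaries k X n).mkQ (complexToSingChain k X n _))
      rw [complexToSingChain_singChainToComplex]
    change ψ ((singBoundaries k X n).mkQ c) = 0
    rw [h1]
    -- For `n = 0` no `m` qualifies, in agreement with every 0-chain being a cycle.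
    by_cases hm : m + 1 = n
    · subst hm
      rw [d_singChainToComplex, LinearMap.mem_ker.1 hc, map_zero]
      exact map_zero y.hom
    · rw [(singComplex k X).shape n m hm]
      exact map_zero y.hom

theorem totalHomologyDim_le : totalHomologyDim k X ≤ totalCohomologyDim k X :=
  Cardinal.sum_le_sum _ _ (rank_singHomology_le k X)

end SingularCohomology

/-! ### Convex combinations and affine maps -/

section ConvexCombinations

/-- Typeclass version of `Convex ℝ S`. -/
class ConvexSet {E : Type*} [AddCommGroup E] [Module ℝ E] (S : Set E) : Prop where
  convex : Convex ℝ S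

instance (ι : Type*) [Fintype ι] : ConvexSet (stdSimplex ℝ ι) := ⟨convex_stdSimplex ℝ ι⟩

instance {E : Type*} [AddCommGroup E] [Module ℝ E] (S : Set E) [ConvexSet S] :
    ConvexSet (S ×ˢ unitInterval) := ⟨ConvexSet.convex.prod (convex_Icc 0 1)⟩

variable {E : Type*} [AddCommGroup E] [Module ℝ E] {S : Set E} [ConvexSet S]
  {E' : Type*} [AddCommGroup E'] [Module ℝ E'] {S' : Set E'} [ConvexSet S']

/-- The convex combination of a tuple of points of a convex set. -/
def convComb {n : ℕ} (v : Fin (n + 1) → S) (w : stdSimplex ℝ (Fin (n + 1))) : S :=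
  ⟨∑ i, w i • (v i : E), ConvexSet.convex.sum_mem (fun i _ => w.2.1 i) w.2.2 fun i _ => (v i).2⟩

theorem coe_convComb {n : ℕ} (v : Fin (n + 1) → S) (w : stdSimplex ℝ (Fin (n + 1))) :
    (convComb v w : E) = ∑ i, w i • (v i : E) := rfl

theorem convComb_apply {n m : ℕ} (u : Fin (m + 1) → stdSimplex ℝ (Fin (n + 1)))
    (w : stdSimplex ℝ (Fin (m + 1))) (j : Fin (n + 1)) :
    convComb u w j = ∑ i, w i * u i j := by
  refine (congrFun (coe_convComb u w) j).trans ?_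
  rw [Finset.sum_apply]
  rfl

theorem convComb_map {n m : ℕ} (f : Fin (n + 1) → Fin (m + 1)) (v : Fin (m + 1) → S)
    (w : stdSimplex ℝ (Fin (n + 1))) : convComb v (stdSimplex.map f w) = convComb (v ∘ f) w := by
  ext1
  simp only [coe_convComb, stdSimplex.map_coe, FunOnFinite.linearMap_apply_apply, Finset.sum_smul,
    Function.comp_apply]
  rw [← Finset.sum_fiberwise Finset.univ f]
  refine Finset.sum_congr rfl fun j _ => Finset.sum_congr rfl fun i hi => ?_
  rw [(Finset.mem_filter.1 hi).2]

/-- A map of convex sets that preserves convex combinations. -/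
def PreservesConvComb (f : S → S') : Prop :=
  ∀ (n : ℕ) (v : Fin (n + 1) → S) (w : stdSimplex ℝ (Fin (n + 1))),
    f (convComb v w) = convComb (f ∘ v) w

theorem preservesConvComb_convComb {n : ℕ} (v : Fin (n + 1) → S) :
    PreservesConvComb (convComb v) := by
  intro m u w
  ext1
  simp only [coe_convComb, Function.comp_apply, Finset.smul_sum, smul_smul]
  rw [Finset.sum_comm]
  refine Finset.sum_congr rfl fun j _ => ?_
  rw [← Finset.sum_smul]
  congr 1
  exact convComb_apply u w j

theorem convComb_vertex_right {n : ℕ} (v : Fin (n + 1) → S) (i : Fin (n + 1)) :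
    convComb v (stdSimplex.vertex i) = v i := by
  ext1
  simp [coe_convComb, Pi.single_apply]

theorem convComb_vertex {n : ℕ} (w : stdSimplex ℝ (Fin (n + 1))) :
    convComb (fun i => stdSimplex.vertex (S := ℝ) i) w = w := by
  ext j
  rw [convComb_apply]
  simp [Pi.single_apply]

/-- The barycenter of a tuple. -/
def tupleBary {n : ℕ} (v : Fin (n + 1) → S) : S := convComb v stdSimplex.barycenter

theorem PreservesConvComb.tupleBary {f : S → S'} (hf : PreservesConvComb f) {n : ℕ}
    (v : Fin (n + 1) → S) : f (tupleBary v) = _root_.tupleBary (f ∘ v) := hf _ _ _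

/-- The inclusion of `S` in `S × I` at height `t`. -/
def cylIncl (t : unitInterval) (x : S) : (S ×ˢ unitInterval : Set (E × ℝ)) :=
  ⟨(x, t), x.2, t.2⟩

/-- The map of cylinders induced by a map `S → S'`. -/
def cylMap (f : S → S') (x : (S ×ˢ unitInterval : Set (E × ℝ))) :
    (S' ×ˢ unitInterval : Set (E' × ℝ)) :=
  ⟨(f ⟨x.1.1, x.2.1⟩, x.1.2), (f _).2, x.2.2⟩

theorem preservesConvComb_cylIncl (t : unitInterval) :
    PreservesConvComb (cylIncl (S := S) t) := by
  intro n v w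
  ext1
  rw [coe_convComb]
  refine Prod.ext ?_ ?_
  · simp only [cylIncl, Prod.fst_sum, Prod.smul_fst, Function.comp_apply, coe_convComb]
  · simp only [cylIncl, Prod.snd_sum, Prod.smul_snd, Function.comp_apply, smul_eq_mul,
      ← Finset.sum_mul, stdSimplex.sum_eq_one, one_mul]

theorem PreservesConvComb.cylMap {f : S → S'} (hf : PreservesConvComb f) :
    PreservesConvComb (cylMap f) := by
  intro n v w
  ext1
  rw [coe_convComb]
  refine Prod.ext ?_ ?_
  · simp only [_root_.cylMap, Prod.fst_sum, Prod.smul_fst, Function.comp_apply]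
    have : (⟨(convComb v w).1.1, (convComb v w).2.1⟩ : S) =
        convComb (fun i => ⟨(v i).1.1, (v i).2.1⟩) w := by
      ext1
      simp only [coe_convComb, Prod.fst_sum, Prod.smul_fst]
    rw [this, hf, coe_convComb]
    rfl
  · simp only [_root_.cylMap, Prod.snd_sum, Prod.smul_snd, Function.comp_apply, coe_convComb]

end ConvexCombinations

/-! ### Formal chains on tuples, cones and cone homotopies -/

section TupleChains

variable (k : Type u) [Field k]

/-- Formal chains on ordered tuples of points of `S`. -/
abbrev TupleChain (S : Type*) (n : ℕ) := (Fin (n + 1) → S) →₀ k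

/-- The boundary of formal chains. -/
def tupleBoundary (S : Type*) (n : ℕ) : TupleChain k S (n + 1) →ₗ[k] TupleChain k S n :=
  altBoundary k fun i v => v ∘ i.succAbove

/-- The map on formal chains induced by a map. -/
def tupleMap {S S' : Type*} (f : S → S') (n : ℕ) : TupleChain k S n →ₗ[k] TupleChain k S' n :=
  Finsupp.lmapDomain k k (f ∘ ·)

/-- The cone operator on formal chains. -/
def tupleCone {S : Type*} (b : S) (n : ℕ) : TupleChain k S n →ₗ[k] TupleChain k S (n + 1) :=
  Finsupp.lmapDomain k k fun v => Fin.cons b v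

/-- The augmentation of formal chains. -/
def tupleAug (S : Type*) : TupleChain k S 0 →ₗ[k] k :=
  Finsupp.linearCombination k fun _ => (1 : k)

variable {k} {S S' T T' : Type*} {n : ℕ}

theorem tupleBoundary_single (v : Fin (n + 2) → S) (x : k) :
    tupleBoundary k S n (Finsupp.single v x) =
      ∑ i : Fin (n + 2), Finsupp.single (v ∘ i.succAbove) ((-1 : k) ^ (i : ℕ) * x) :=
  altBoundary_single _ _ _

@[simp]
theorem tupleMap_single (f : S → S') (v : Fin (n + 1) → S) (x : k) :
    tupleMap k f n (Finsupp.single v x) = Finsupp.single (f ∘ v) x := by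
  rw [tupleMap, Finsupp.lmapDomain_apply, Finsupp.mapDomain_single]

@[simp]
theorem tupleCone_single (b : S) (v : Fin (n + 1) → S) (x : k) :
    tupleCone k b n (Finsupp.single v x) = Finsupp.single (Fin.cons b v) x := by
  rw [tupleCone, Finsupp.lmapDomain_apply, Finsupp.mapDomain_single]

@[simp]
theorem tupleAug_single (v : Fin 1 → S) (x : k) :
    tupleAug k S (Finsupp.single v x) = x := by
  simp [tupleAug]

theorem tupleBoundary_tupleMap (f : S → S') (c : TupleChain k S (n + 1)) :
    tupleBoundary k S' n (tupleMap k f (n + 1) c) = tupleMap k f n (tupleBoundary k S n c) := by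
  simp only [tupleMap, tupleBoundary, Finsupp.lmapDomain_apply]
  exact altBoundary_mapDomain _ _ _ _ (fun i v => Function.comp_assoc f v _) c

theorem tupleAug_tupleMap (f : S → S') (c : TupleChain k S 0) :
    tupleAug k S' (tupleMap k f 0 c) = tupleAug k S c := by
  induction c using Finsupp.induction_linear with
  | zero => simp
  | add a b ha hb => simp only [map_add, ha, hb]
  | single v x => simp

theorem tupleBoundary_tupleBoundary (c : TupleChain k S (n + 2)) :
    tupleBoundary k S n (tupleBoundary k S (n + 1) c) = 0 := by
  refine altBoundary_altBoundary _ _ (fun i j v hij => ?_) c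
  funext x
  exact congrArg v (Fin.succ_succAbove_succAbove_of_le hij x)

theorem tupleAug_tupleBoundary (c : TupleChain k S 1) :
    tupleAug k S (tupleBoundary k S 0 c) = 0 := by
  induction c using Finsupp.induction_linear with
  | zero => simp
  | add a b ha hb => simp only [map_add, ha, hb, add_zero]
  | single v x =>
    rw [tupleBoundary_single, Fin.sum_univ_two, map_add, tupleAug_single, tupleAug_single]
    simp

theorem tupleMap_tupleCone (f : S → S') (b : S) (c : TupleChain k S n) :
    tupleMap k f (n + 1) (tupleCone k b n c) = tupleCone k (f b) n (tupleMap k f n c) := by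
  induction c using Finsupp.induction_linear with
  | zero => simp
  | add a b ha hb => simp only [map_add, ha, hb]
  | single v x =>
    rw [tupleCone_single, tupleMap_single, tupleMap_single, tupleCone_single]
    congr 1
    funext i
    refine Fin.cases ?_ (fun j => ?_) i <;> simp

/-- Omitting the apex returns `c`; omitting any other vertex gives the cone on a face, with the
index shifted by one and hence the sign reversed. -/
theorem tupleBoundary_tupleCone (b : S) (c : TupleChain k S (n + 1)) :
    tupleBoundary k S (n + 1) (tupleCone k b (n + 1) c) =
      c - tupleCone k b n (tupleBoundary k S n c) := by
  induction c using Finsupp.induction_linear with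
  | zero => simp
  | add x y hx hy => simp only [map_add, hx, hy]; abel
  | single v x =>
    rw [tupleCone_single, tupleBoundary_single, Fin.sum_univ_succ, tupleBoundary_single, map_sum,
      sub_eq_add_neg, ← Finset.sum_neg_distrib]
    congr 1
    · simp only [Fin.val_zero, pow_zero, one_mul]
      congr 1
    · refine Finset.sum_congr rfl fun i _ => ?_
      rw [tupleCone_single, ← Finsupp.single_neg]
      congr 1
      · funext j
        refine Fin.cases ?_ (fun j => ?_) j <;> simp
      · simp [pow_succ]

/-- In degree 0, omitting the only base vertex leaves the apex, so the correction term is the apex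
weighted by the augmentation. -/
theorem tupleBoundary_tupleCone_zero (b : S) (c : TupleChain k S 0) (hc : tupleAug k S c = 0) :
    tupleBoundary k S 0 (tupleCone k b 0 c) = c := by
  have : tupleBoundary k S 0 (tupleCone k b 0 c) =
      c - Finsupp.single (fun _ => b) (tupleAug k S c) := by
    clear hc
    induction c using Finsupp.induction_linear with
    | zero => simp
    | add x y hx hy => simp only [map_add, hx, hy, Finsupp.single_add]; abel
    | single v x =>
      rw [tupleCone_single, tupleBoundary_single, Fin.sum_univ_two, tupleAug_single,
        sub_eq_add_neg, ← Finsupp.single_neg]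
      congr 1
      · simp only [Fin.val_zero, pow_zero, one_mul]
        congr 1
      · congr 1
        · funext j
          fin_cases j
          simp
        · simp
  rw [this, hc, Finsupp.single_zero, sub_zero]

variable (F G : ∀ n, TupleChain k S n →ₗ[k] TupleChain k S' n)
  (b : ∀ n, (Fin (n + 1) → S) → S')

/-- The homotopy between two augmentation-preserving chain maps of formal chains obtained by
coning off with apices `b`. -/
def tupleHomotopy : ∀ n, TupleChain k S n →ₗ[k] TupleChain k S' (n + 1)
  | 0 => Finsupp.linearCombination k fun v =>
      tupleCone k (b 0 v) 0 (F 0 (Finsupp.single v 1) - G 0 (Finsupp.single v 1))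
  | n + 1 => Finsupp.linearCombination k fun v =>
      tupleCone k (b (n + 1) v) (n + 1) (F (n + 1) (Finsupp.single v 1) -
        G (n + 1) (Finsupp.single v 1) -
          tupleHomotopy n (tupleBoundary k S n (Finsupp.single v 1)))

theorem tupleHomotopy_zero_single (v : Fin 1 → S) :
    tupleHomotopy F G b 0 (Finsupp.single v 1) =
      tupleCone k (b 0 v) 0 (F 0 (Finsupp.single v 1) - G 0 (Finsupp.single v 1)) := by
  rw [tupleHomotopy, Finsupp.linearCombination_single, one_smul]

theorem tupleHomotopy_succ_single (v : Fin (n + 2) → S) :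
    tupleHomotopy F G b (n + 1) (Finsupp.single v 1) =
      tupleCone k (b (n + 1) v) (n + 1) (F (n + 1) (Finsupp.single v 1) -
        G (n + 1) (Finsupp.single v 1) -
          tupleHomotopy F G b n (tupleBoundary k S n (Finsupp.single v 1))) := by
  rw [tupleHomotopy, Finsupp.linearCombination_single, one_smul]

variable {F G}

theorem TupleChain.linearMap_ext {M : Type*} [AddCommMonoid M] [Module k M]
    {f g : TupleChain k S n →ₗ[k] M}
    (h : ∀ v, f (Finsupp.single v 1) = g (Finsupp.single v 1)) (c : TupleChain k S n) :
    f c = g c := by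
  have : f = g := Finsupp.lhom_ext fun v x => by
    rw [← mul_one x, ← smul_eq_mul, ← Finsupp.smul_single, map_smul, map_smul, h]
  rw [this]

theorem tupleBoundary_tupleHomotopy_zero
    (hFG : ∀ c, tupleAug k S' (F 0 c) = tupleAug k S' (G 0 c)) (c : TupleChain k S 0) :
    tupleBoundary k S' 0 (tupleHomotopy F G b 0 c) = F 0 c - G 0 c := by
  refine TupleChain.linearMap_ext (f := tupleBoundary k S' 0 ∘ₗ tupleHomotopy F G b 0)
    (g := F 0 - G 0) (fun v => ?_) c
  rw [LinearMap.comp_apply, tupleHomotopy_zero_single,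
    tupleBoundary_tupleCone_zero]
  · rfl
  · rw [map_sub, hFG, sub_self]

/-- By the formula one degree lower, the chain that is coned off is a cycle, and the cone on a cycle
has that cycle as its boundary. The apices `b` may be arbitrary. -/
theorem tupleBoundary_tupleHomotopy_succ
    (hFG : ∀ c, tupleAug k S' (F 0 c) = tupleAug k S' (G 0 c))
    (hF : ∀ n c, tupleBoundary k S' n (F (n + 1) c) = F n (tupleBoundary k S n c))
    (hG : ∀ n c, tupleBoundary k S' n (G (n + 1) c) = G n (tupleBoundary k S n c)) (n : ℕ)
    (c : TupleChain k S (n + 1)) :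
    tupleBoundary k S' (n + 1) (tupleHomotopy F G b (n + 1) c) =
      F (n + 1) c - G (n + 1) c - tupleHomotopy F G b n (tupleBoundary k S n c) := by
  induction n with
  | zero =>
    refine TupleChain.linearMap_ext (f := tupleBoundary k S' 1 ∘ₗ tupleHomotopy F G b 1)
      (g := F 1 - G 1 - tupleHomotopy F G b 0 ∘ₗ tupleBoundary k S 0) (fun v => ?_) c
    rw [LinearMap.comp_apply, tupleHomotopy_succ_single, tupleBoundary_tupleCone,
      map_sub (tupleBoundary k S' 0), map_sub (tupleBoundary k S' 0), tupleBoundary_tupleHomotopy_zero b hFG, hF, hG,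
      sub_self, map_zero, sub_zero]
    rfl
  | succ n ih =>
    refine TupleChain.linearMap_ext (f := tupleBoundary k S' (n + 2) ∘ₗ tupleHomotopy F G b (n + 2))
      (g := F (n + 2) - G (n + 2) - tupleHomotopy F G b (n + 1) ∘ₗ tupleBoundary k S (n + 1))
      (fun v => ?_) c
    rw [LinearMap.comp_apply, tupleHomotopy_succ_single, tupleBoundary_tupleCone,
      map_sub (tupleBoundary k S' (n + 1)), map_sub (tupleBoundary k S' (n + 1)), ih, hF, hG,
      tupleBoundary_tupleBoundary, map_zero, sub_zero, sub_self, map_zero, sub_zero]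
    rfl

/-- The only choice in the construction is that of the apices, so compatible apices give naturality.
Naturality is what transfers the homotopies to singular chains. -/
theorem tupleMap_tupleHomotopy {F' G' : ∀ n, TupleChain k T n →ₗ[k] TupleChain k T' n}
    {b' : ∀ n, (Fin (n + 1) → T) → T'} (f : S → T) (f' : S' → T')
    (hF : ∀ n c, F' n (tupleMap k f n c) = tupleMap k f' n (F n c))
    (hG : ∀ n c, G' n (tupleMap k f n c) = tupleMap k f' n (G n c))
    (hb : ∀ n v, b' n (f ∘ v) = f' (b n v)) (n : ℕ) (c : TupleChain k S n) :
    tupleHomotopy F' G' b' n (tupleMap k f n c) =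
      tupleMap k f' (n + 1) (tupleHomotopy F G b n c) := by
  induction n with
  | zero =>
    refine TupleChain.linearMap_ext (f := tupleHomotopy F' G' b' 0 ∘ₗ tupleMap k f 0)
      (g := tupleMap k f' 1 ∘ₗ tupleHomotopy F G b 0) (fun v => ?_) c
    rw [LinearMap.comp_apply, LinearMap.comp_apply, tupleMap_single, tupleHomotopy_zero_single,
      tupleHomotopy_zero_single,
      tupleMap_tupleCone, hb, map_sub (tupleMap k f' 0), ← hF, ← hG, tupleMap_single]
  | succ n ih =>
    refine TupleChain.linearMap_ext (f := tupleHomotopy F' G' b' (n + 1) ∘ₗ tupleMap k f (n + 1))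
      (g := tupleMap k f' (n + 2) ∘ₗ tupleHomotopy F G b (n + 1)) (fun v => ?_) c
    rw [LinearMap.comp_apply, LinearMap.comp_apply, tupleMap_single, tupleHomotopy_succ_single,
      tupleHomotopy_succ_single,
      tupleMap_tupleCone, hb, map_sub (tupleMap k f' (n + 1)), map_sub (tupleMap k f' (n + 1)),
      ← hF, ← hG, ← ih, ← tupleBoundary_tupleMap, tupleMap_single]

end TupleChains

/-! ### Barycentric subdivision of formal chains -/

section Subdivision

variable (k : Type u) [Field k] {E : Type*} [AddCommGroup E] [Module ℝ E] (S : Set E) [ConvexSet S]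
  {E' : Type*} [AddCommGroup E'] [Module ℝ E'] {S' : Set E'} [ConvexSet S']

/-- Barycentric subdivision of formal chains in a convex set. -/
def tupleSd : ∀ n, TupleChain k S n →ₗ[k] TupleChain k S n
  | 0 => LinearMap.id
  | n + 1 => Finsupp.linearCombination k fun v =>
      tupleCone k (tupleBary v) n (tupleSd n (tupleBoundary k S n (Finsupp.single v 1)))

/-- The homotopy from the identity to barycentric subdivision. -/
def tupleSdHomotopy : ∀ n, TupleChain k S n →ₗ[k] TupleChain k S (n + 1) :=
  tupleHomotopy (fun _ => LinearMap.id) (tupleSd k S) fun _ => tupleBary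

variable {k S}

theorem tupleSd_succ_single {n : ℕ} (v : Fin (n + 2) → S) :
    tupleSd k S (n + 1) (Finsupp.single v 1) =
      tupleCone k (tupleBary v) n (tupleSd k S n (tupleBoundary k S n (Finsupp.single v 1))) := by
  rw [tupleSd, Finsupp.linearCombination_single, one_smul]

theorem tupleBoundary_tupleSd (n : ℕ) (c : TupleChain k S (n + 1)) :
    tupleBoundary k S n (tupleSd k S (n + 1) c) = tupleSd k S n (tupleBoundary k S n c) := by
  induction n with
  | zero =>
    refine TupleChain.linearMap_ext (f := tupleBoundary k S 0 ∘ₗ tupleSd k S 1)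
      (g := tupleSd k S 0 ∘ₗ tupleBoundary k S 0) (fun v => ?_) c
    rw [LinearMap.comp_apply, tupleSd_succ_single,
      tupleBoundary_tupleCone_zero]
    · rfl
    · exact tupleAug_tupleBoundary _
  | succ n ih =>
    refine TupleChain.linearMap_ext (f := tupleBoundary k S (n + 1) ∘ₗ tupleSd k S (n + 2))
      (g := tupleSd k S (n + 1) ∘ₗ tupleBoundary k S (n + 1)) (fun v => ?_) c
    rw [LinearMap.comp_apply, tupleSd_succ_single,
      tupleBoundary_tupleCone, ih, tupleBoundary_tupleBoundary, map_zero, map_zero, sub_zero]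
    rfl

/-- Maps that preserve convex combinations carry barycentres to barycentres. -/
theorem tupleSd_tupleMap {f : S → S'} (hf : PreservesConvComb f) (n : ℕ) (c : TupleChain k S n) :
    tupleSd k S' n (tupleMap k f n c) = tupleMap k f n (tupleSd k S n c) := by
  induction n with
  | zero => rfl
  | succ n ih =>
    refine TupleChain.linearMap_ext (f := tupleSd k S' (n + 1) ∘ₗ tupleMap k f (n + 1))
      (g := tupleMap k f (n + 1) ∘ₗ tupleSd k S (n + 1)) (fun v => ?_) c
    rw [LinearMap.comp_apply, LinearMap.comp_apply, tupleMap_single, tupleSd_succ_single,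
      tupleSd_succ_single,
      tupleMap_tupleCone, hf.tupleBary, ← ih, ← tupleBoundary_tupleMap, tupleMap_single]

theorem tupleSdHomotopy_tupleMap {f : S → S'} (hf : PreservesConvComb f) (n : ℕ)
    (c : TupleChain k S n) :
    tupleSdHomotopy k S' n (tupleMap k f n c) =
      tupleMap k f (n + 1) (tupleSdHomotopy k S n c) :=
  tupleMap_tupleHomotopy (F := fun _ => LinearMap.id) (F' := fun _ => LinearMap.id) _ f f
    (fun _ _ => rfl) (tupleSd_tupleMap hf) (fun _ v => (hf.tupleBary v).symm) n c

end Subdivision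

/-! ### The prism operator on formal chains -/

section TuplePrism

variable (k : Type u) [Field k] {E E' : Type*} (S : Set E) {S' : Set E'}

/-- The prism operator on formal chains. -/
def tuplePrism : ∀ n, TupleChain k S n →ₗ[k]
    TupleChain k (S ×ˢ unitInterval : Set (E × ℝ)) (n + 1) :=
  tupleHomotopy (fun n => tupleMap k (cylIncl 1) n) (fun n => tupleMap k (cylIncl 0) n)
    fun _ v => cylIncl 0 (v 0)

variable {k S} {n : ℕ}

/-- The apex depends only on the first vertex of the tuple, so `f` need not be affine. -/
theorem tuplePrism_tupleMap (f : S → S') (c : TupleChain k S n) :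
    tuplePrism k S' n (tupleMap k f n c) = tupleMap k (cylMap f) (n + 1) (tuplePrism k S n c) := by
  refine tupleMap_tupleHomotopy _ f (cylMap f) (fun n c => ?_) (fun n c => ?_) (fun n v => rfl) n c
  all_goals
    refine TupleChain.linearMap_ext (f := tupleMap k _ n ∘ₗ tupleMap k f n)
      (g := tupleMap k (cylMap f) n ∘ₗ tupleMap k _ n) (fun v => ?_) c
    simp only [LinearMap.comp_apply, tupleMap_single]
    rfl

end TuplePrism

/-! ### Subdivision and prisms on singular chains -/

section Realization

variable {k : Type u} [Field k] {E : Type*} [AddCommGroup E] [Module ℝ E] [TopologicalSpace E]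
  [ContinuousAdd E] [ContinuousSMul ℝ E] {S : Set E} [ConvexSet S]
  {E' : Type*} [AddCommGroup E'] [Module ℝ E'] [TopologicalSpace E']
  [ContinuousAdd E'] [ContinuousSMul ℝ E'] {S' : Set E'} [ConvexSet S']
  {X Y : Type*} [TopologicalSpace X] [TopologicalSpace Y] {n : ℕ}

/-- The affine singular simplex spanned by a tuple of points. -/
def affineSimplex (v : Fin (n + 1) → S) : C(stdSimplex ℝ (Fin (n + 1)), S) where
  toFun := convComb v
  continuous_toFun := by
    refine Continuous.subtype_mk (continuous_finsetSum _ fun i _ => ?_) _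
    exact (((continuous_apply i).comp continuous_subtype_val)).smul continuous_const

theorem preservesConvComb_affineSimplex (v : Fin (n + 1) → S) :
    PreservesConvComb (affineSimplex v) := preservesConvComb_convComb v

variable (k) in
/-- The singular chain obtained by applying a continuous map to the affine simplices of
a formal chain. -/
def applyTuple (σ : C(S, X)) (n : ℕ) : TupleChain k S n →ₗ[k] SingChain k X n :=
  Finsupp.lmapDomain k k fun v => σ.comp (affineSimplex v)

@[simp]
theorem applyTuple_single (σ : C(S, X)) (v : Fin (n + 1) → S) (x : k) :
    applyTuple k σ n (Finsupp.single v x) = Finsupp.single (σ.comp (affineSimplex v)) x := by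
  rw [applyTuple, Finsupp.lmapDomain_apply, Finsupp.mapDomain_single]

theorem singBoundary_applyTuple (σ : C(S, X)) (c : TupleChain k S (n + 1)) :
    singBoundary k X n (applyTuple k σ (n + 1) c) = applyTuple k σ n (tupleBoundary k S n c) := by
  simp only [applyTuple, singBoundary, tupleBoundary, Finsupp.lmapDomain_apply]
  refine altBoundary_mapDomain _ _ _ _ (fun i v => ?_) c
  ext1 w
  exact congrArg σ (convComb_map i.succAbove v w)

theorem singMap_applyTuple (g : C(X, Y)) (σ : C(S, X)) (c : TupleChain k S n) :
    singMap k g n (applyTuple k σ n c) = applyTuple k (g.comp σ) n c := by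
  refine TupleChain.linearMap_ext (f := singMap k g n ∘ₗ applyTuple k σ n)
    (g := applyTuple k (g.comp σ) n) (fun v => ?_) c
  rw [LinearMap.comp_apply, applyTuple_single, applyTuple_single, singMap_single,
    ContinuousMap.comp_assoc]

theorem applyTuple_tupleMap (σ : C(S', X)) (f : C(S, S')) (hf : PreservesConvComb f)
    (c : TupleChain k S n) :
    applyTuple k σ n (tupleMap k f n c) = applyTuple k (σ.comp f) n c := by
  refine TupleChain.linearMap_ext (f := applyTuple k σ n ∘ₗ tupleMap k f n)
    (g := applyTuple k (σ.comp f) n) (fun v => ?_) c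
  rw [LinearMap.comp_apply, tupleMap_single, applyTuple_single, applyTuple_single]
  congr 1
  ext1 w
  exact congrArg σ (hf _ v w).symm

/-- The tuple of vertices of the standard simplex. -/
def stdTuple (n : ℕ) : Fin (n + 1) → stdSimplex ℝ (Fin (n + 1)) :=
  fun i => stdSimplex.vertex i

theorem affineSimplex_comp_stdTuple (v : Fin (n + 1) → S) :
    ⇑(affineSimplex v) ∘ stdTuple n = v :=
  funext fun i => convComb_vertex_right v i

theorem applyTuple_stdTuple (σ : C(stdSimplex ℝ (Fin (n + 1)), X)) (x : k) :
    applyTuple k σ n (Finsupp.single (stdTuple n) x) = Finsupp.single σ x := by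
  rw [applyTuple_single]
  congr 1
  ext1 w
  exact congrArg σ (convComb_vertex w)

theorem SingChain.linearMap_ext {M : Type*} [AddCommMonoid M] [Module k M]
    {f g : SingChain k X n →ₗ[k] M}
    (h : ∀ σ, f (Finsupp.single σ 1) = g (Finsupp.single σ 1)) (c : SingChain k X n) :
    f c = g c := by
  have : f = g := Finsupp.lhom_ext fun v x => by
    rw [← mul_one x, ← smul_eq_mul, ← Finsupp.smul_single, map_smul, map_smul, h]
  rw [this]

variable (k X)

/-- Barycentric subdivision of singular chains. -/
def singSd (n : ℕ) : SingChain k X n →ₗ[k] SingChain k X n :=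
  Finsupp.linearCombination k fun σ =>
    applyTuple k σ n (tupleSd k _ n (Finsupp.single (stdTuple n) 1))

/-- The homotopy from the identity to barycentric subdivision of singular chains. -/
def singSdHomotopy (n : ℕ) : SingChain k X n →ₗ[k] SingChain k X (n + 1) :=
  Finsupp.linearCombination k fun σ =>
    applyTuple k σ (n + 1) (tupleSdHomotopy k _ n (Finsupp.single (stdTuple n) 1))

variable {k X}

theorem singSd_single (σ : C(stdSimplex ℝ (Fin (n + 1)), X)) :
    singSd k X n (Finsupp.single σ 1) =
      applyTuple k σ n (tupleSd k _ n (Finsupp.single (stdTuple n) 1)) := by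
  rw [singSd, Finsupp.linearCombination_single, one_smul]

theorem singSdHomotopy_single (σ : C(stdSimplex ℝ (Fin (n + 1)), X)) :
    singSdHomotopy k X n (Finsupp.single σ 1) =
      applyTuple k σ (n + 1) (tupleSdHomotopy k _ n (Finsupp.single (stdTuple n) 1)) := by
  rw [singSdHomotopy, Finsupp.linearCombination_single, one_smul]

/-- An affine simplex is the image of the standard vertices under an affine map, so naturality
carries the universal formula to every tuple. Identities between operators on singular chains
thereby reduce to formal ones. -/
theorem singSd_applyTuple (σ : C(S, X)) (c : TupleChain k S n) :
    singSd k X n (applyTuple k σ n c) = applyTuple k σ n (tupleSd k S n c) := by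
  refine TupleChain.linearMap_ext (f := singSd k X n ∘ₗ applyTuple k σ n)
    (g := applyTuple k σ n ∘ₗ tupleSd k S n) (fun v => ?_) c
  rw [LinearMap.comp_apply, LinearMap.comp_apply, applyTuple_single, singSd_single,
    ← applyTuple_tupleMap σ _ (preservesConvComb_affineSimplex v),
    ← tupleSd_tupleMap (preservesConvComb_affineSimplex v), tupleMap_single,
    affineSimplex_comp_stdTuple]

theorem singSdHomotopy_applyTuple (σ : C(S, X)) (c : TupleChain k S n) :
    singSdHomotopy k X n (applyTuple k σ n c) =
      applyTuple k σ (n + 1) (tupleSdHomotopy k S n c) := by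
  refine TupleChain.linearMap_ext (f := singSdHomotopy k X n ∘ₗ applyTuple k σ n)
    (g := applyTuple k σ (n + 1) ∘ₗ tupleSdHomotopy k S n) (fun v => ?_) c
  rw [LinearMap.comp_apply, LinearMap.comp_apply, applyTuple_single, singSdHomotopy_single,
    ← applyTuple_tupleMap σ _ (preservesConvComb_affineSimplex v),
    ← tupleSdHomotopy_tupleMap (preservesConvComb_affineSimplex v), tupleMap_single,
    affineSimplex_comp_stdTuple]

theorem singBoundary_singSd (c : SingChain k X (n + 1)) :
    singBoundary k X n (singSd k X (n + 1) c) = singSd k X n (singBoundary k X n c) := by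
  refine SingChain.linearMap_ext (f := singBoundary k X n ∘ₗ singSd k X (n + 1))
    (g := singSd k X n ∘ₗ singBoundary k X n) (fun σ => ?_) c
  rw [LinearMap.comp_apply, LinearMap.comp_apply, ← applyTuple_stdTuple σ, singSd_applyTuple,
    singBoundary_applyTuple, singBoundary_applyTuple, singSd_applyTuple, tupleBoundary_tupleSd]

theorem singSd_singMap (g : C(X, Y)) (c : SingChain k X n) :
    singSd k Y n (singMap k g n c) = singMap k g n (singSd k X n c) := by
  refine SingChain.linearMap_ext (f := singSd k Y n ∘ₗ singMap k g n)
    (g := singMap k g n ∘ₗ singSd k X n) (fun σ => ?_) c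
  rw [LinearMap.comp_apply, LinearMap.comp_apply, singMap_single, singSd_single, singSd_single,
    singMap_applyTuple]

theorem singSd_zero (c : SingChain k X 0) : singSd k X 0 c = c := by
  refine SingChain.linearMap_ext (f := singSd k X 0) (g := LinearMap.id) (fun σ => ?_) c
  rw [singSd_single, tupleSd]
  exact applyTuple_stdTuple σ 1

theorem singBoundary_singSdHomotopy (c : SingChain k X (n + 1)) :
    singBoundary k X (n + 1) (singSdHomotopy k X (n + 1) c) =
      c - singSd k X (n + 1) c - singSdHomotopy k X n (singBoundary k X n c) := by
  refine SingChain.linearMap_ext (f := singBoundary k X (n + 1) ∘ₗ singSdHomotopy k X (n + 1))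
    (g := LinearMap.id - singSd k X (n + 1) - singSdHomotopy k X n ∘ₗ singBoundary k X n)
    (fun σ => ?_) c
  simp only [LinearMap.comp_apply, LinearMap.sub_apply, LinearMap.id_apply]
  rw [← applyTuple_stdTuple σ, singSdHomotopy_applyTuple, singBoundary_applyTuple,
    singBoundary_applyTuple, singSdHomotopy_applyTuple, singSd_applyTuple, tupleSdHomotopy,
    tupleBoundary_tupleHomotopy_succ, map_sub, map_sub]
  · rfl
  · intro c; rfl
  · intro n c; rfl
  · exact tupleBoundary_tupleSd

/-- The map `S × I → Y` obtained from a singular simplex and a homotopy. -/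
def cylApply (H : C(X × unitInterval, Y)) (σ : C(S, X)) :
    C((S ×ˢ unitInterval : Set (E × ℝ)), Y) :=
  H.comp ⟨fun x => (σ ⟨x.1.1, x.2.1⟩, ⟨x.1.2, x.2.2⟩), by fun_prop⟩

variable (k) in
/-- The prism operator on singular chains. -/
def singPrism (H : C(X × unitInterval, Y)) (n : ℕ) : SingChain k X n →ₗ[k] SingChain k Y (n + 1) :=
  Finsupp.linearCombination k fun σ =>
    applyTuple k (cylApply H σ) (n + 1) (tuplePrism k _ n (Finsupp.single (stdTuple n) 1))

theorem singPrism_single (H : C(X × unitInterval, Y)) (σ : C(stdSimplex ℝ (Fin (n + 1)), X)) :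
    singPrism k H n (Finsupp.single σ 1) =
      applyTuple k (cylApply H σ) (n + 1) (tuplePrism k _ n (Finsupp.single (stdTuple n) 1)) := by
  rw [singPrism, Finsupp.linearCombination_single, one_smul]

theorem singPrism_applyTuple (H : C(X × unitInterval, Y)) (σ : C(S, X)) (c : TupleChain k S n) :
    singPrism k H n (applyTuple k σ n c) =
      applyTuple k (cylApply H σ) (n + 1) (tuplePrism k S n c) := by
  refine TupleChain.linearMap_ext (f := singPrism k H n ∘ₗ applyTuple k σ n)
    (g := applyTuple k (cylApply H σ) (n + 1) ∘ₗ tuplePrism k S n) (fun v => ?_) c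
  let f : C((stdSimplex ℝ (Fin (n + 1)) ×ˢ unitInterval : Set ((Fin (n + 1) → ℝ) × ℝ)),
      (S ×ˢ unitInterval : Set (E × ℝ))) :=
    ⟨cylMap (affineSimplex v), Continuous.subtype_mk ((continuous_subtype_val.comp
      ((affineSimplex v).continuous.comp (Continuous.subtype_mk
        (continuous_fst.comp continuous_subtype_val) _))).prodMk
          (continuous_snd.comp continuous_subtype_val)) _⟩
  have hf : PreservesConvComb f := (preservesConvComb_affineSimplex v).cylMap
  have h1 : cylApply H (σ.comp (affineSimplex v)) = (cylApply H σ).comp f := rfl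
  rw [LinearMap.comp_apply, LinearMap.comp_apply, applyTuple_single, singPrism_single, h1,
    ← applyTuple_tupleMap _ f hf]
  have h2 := tuplePrism_tupleMap (k := k) (affineSimplex v) (Finsupp.single (stdTuple n) 1)
  rw [tupleMap_single, affineSimplex_comp_stdTuple] at h2
  rw [h2]
  rfl

theorem applyTuple_cylApply (H : C(X × unitInterval, Y)) (σ : C(S, X)) (t : unitInterval)
    (c : TupleChain k S n) :
    applyTuple k (cylApply H σ) n (tupleMap k (cylIncl t) n c) =
      singMap k (H.comp ⟨fun x => (x, t), by fun_prop⟩) n (applyTuple k σ n c) := by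
  have := applyTuple_tupleMap (k := k) (cylApply H σ) ⟨cylIncl t, by unfold cylIncl; fun_prop⟩
    (preservesConvComb_cylIncl t) c
  refine this.trans ?_
  rw [singMap_applyTuple]
  rfl

theorem singBoundary_singPrism_zero (H : C(X × unitInterval, Y)) (c : SingChain k X 0) :
    singBoundary k Y 0 (singPrism k H 0 c) =
      singMap k (H.comp ⟨fun x => (x, 1), by fun_prop⟩) 0 c -
        singMap k (H.comp ⟨fun x => (x, 0), by fun_prop⟩) 0 c := by
  refine SingChain.linearMap_ext (f := singBoundary k Y 0 ∘ₗ singPrism k H 0)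
    (g := singMap k (H.comp ⟨fun x => (x, 1), by fun_prop⟩) 0 -
      singMap k (H.comp ⟨fun x => (x, 0), by fun_prop⟩) 0) (fun σ => ?_) c
  rw [LinearMap.comp_apply, LinearMap.sub_apply, ← applyTuple_stdTuple σ, singPrism_applyTuple,
    singBoundary_applyTuple, tuplePrism, tupleBoundary_tupleHomotopy_zero, map_sub,
    applyTuple_cylApply, applyTuple_cylApply]
  intro c
  rw [tupleAug_tupleMap, tupleAug_tupleMap]

theorem singBoundary_singPrism_succ (H : C(X × unitInterval, Y)) (c : SingChain k X (n + 1)) :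
    singBoundary k Y (n + 1) (singPrism k H (n + 1) c) =
      singMap k (H.comp ⟨fun x => (x, 1), by fun_prop⟩) (n + 1) c -
        singMap k (H.comp ⟨fun x => (x, 0), by fun_prop⟩) (n + 1) c -
          singPrism k H n (singBoundary k X n c) := by
  refine SingChain.linearMap_ext (f := singBoundary k Y (n + 1) ∘ₗ singPrism k H (n + 1))
    (g := singMap k (H.comp ⟨fun x => (x, 1), by fun_prop⟩) (n + 1) -
      singMap k (H.comp ⟨fun x => (x, 0), by fun_prop⟩) (n + 1) -
        singPrism k H n ∘ₗ singBoundary k X n) (fun σ => ?_) c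
  rw [LinearMap.comp_apply, LinearMap.sub_apply, LinearMap.sub_apply, LinearMap.comp_apply,
    ← applyTuple_stdTuple σ, singPrism_applyTuple, singBoundary_applyTuple,
    singBoundary_applyTuple, singPrism_applyTuple, tuplePrism, tupleBoundary_tupleHomotopy_succ,
    map_sub, map_sub, applyTuple_cylApply, applyTuple_cylApply]
  · intro c
    rw [tupleAug_tupleMap, tupleAug_tupleMap]
  · exact fun n c => tupleBoundary_tupleMap _ c
  · exact fun n c => tupleBoundary_tupleMap _ c

theorem singMap_singPrism {Z : Type*} [TopologicalSpace Z] (g : C(Y, Z))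
    (H : C(X × unitInterval, Y)) (c : SingChain k X n) :
    singMap k g (n + 1) (singPrism k H n c) = singPrism k (g.comp H) n c := by
  refine SingChain.linearMap_ext (f := singMap k g (n + 1) ∘ₗ singPrism k H n)
    (g := singPrism k (g.comp H) n) (fun σ => ?_) c
  rw [LinearMap.comp_apply, singPrism_single, singPrism_single, singMap_applyTuple]
  rfl

end Realization

/-! ### Homotopies and iterated subdivision on cycles -/

section CycleLevel

variable {k : Type u} [Field k] {X Y : Type} [TopologicalSpace X] [TopologicalSpace Y] {n : ℕ}

theorem singBoundary_singPrism_of_mem_singCycles (H : C(X × unitInterval, Y)) {c : SingChain k X n}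
    (hc : c ∈ singCycles k X n) :
    singBoundary k Y n (singPrism k H n c) =
      singMap k (H.comp ⟨fun x => (x, 1), by fun_prop⟩) n c -
        singMap k (H.comp ⟨fun x => (x, 0), by fun_prop⟩) n c := by
  cases n with
  | zero => exact singBoundary_singPrism_zero H c
  | succ n =>
    rw [singBoundary_singPrism_succ, LinearMap.mem_ker.1 hc, map_zero, sub_zero]

theorem sub_singSd_mem_singBoundaries {c : SingChain k X n} (hc : c ∈ singCycles k X n) :
    c - singSd k X n c ∈ singBoundaries k X n := by
  cases n with
  | zero =>
    rw [singSd_zero, sub_self]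
    exact Submodule.zero_mem _
  | succ n =>
    refine ⟨singSdHomotopy k X (n + 1) c, ?_⟩
    rw [singBoundary_singSdHomotopy, LinearMap.mem_ker.1 hc, map_zero, sub_zero]

theorem singSd_mem_singCycles {c : SingChain k X n} (hc : c ∈ singCycles k X n) :
    singSd k X n c ∈ singCycles k X n := by
  cases n with
  | zero => trivial
  | succ n =>
    change singBoundary k X n _ = 0
    rw [singBoundary_singSd, LinearMap.mem_ker.1 hc, map_zero]

theorem sub_singSd_pow_mem_singBoundaries {c : SingChain k X n} (hc : c ∈ singCycles k X n)
    (N : ℕ) : (singSd k X n ^ N) c ∈ singCycles k X n ∧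
      c - (singSd k X n ^ N) c ∈ singBoundaries k X n := by
  induction N with
  | zero =>
    refine ⟨hc, ?_⟩
    rw [pow_zero, Module.End.one_apply, sub_self]
    exact Submodule.zero_mem _
  | succ N ih =>
    rw [pow_succ', Module.End.mul_apply]
    refine ⟨singSd_mem_singCycles ih.1, ?_⟩
    rw [← sub_add_sub_cancel c ((singSd k X n ^ N) c)]
    exact Submodule.add_mem _ ih.2 (sub_singSd_mem_singBoundaries ih.1)

theorem singSd_pow_singMap (g : C(X, Y)) (c : SingChain k X n) (N : ℕ) :
    (singSd k Y n ^ N) (singMap k g n c) = singMap k g n ((singSd k X n ^ N) c) := by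
  induction N with
  | zero => rfl
  | succ N ih => rw [pow_succ', pow_succ', Module.End.mul_apply, Module.End.mul_apply, ih,
      singSd_singMap]

theorem singBoundary_singSd_pow (c : SingChain k X (n + 1)) (N : ℕ) :
    singBoundary k X n ((singSd k X (n + 1) ^ N) c) =
      (singSd k X n ^ N) (singBoundary k X n c) := by
  induction N with
  | zero => rfl
  | succ N ih => rw [pow_succ', pow_succ', Module.End.mul_apply, Module.End.mul_apply,
      singBoundary_singSd, ih]

end CycleLevel

/-! ### Shrinking of simplices under subdivision -/

section Mesh

variable {k : Type u} [Field k]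

theorem Finsupp.map_mem_supported {α β : Type*} {f : (α →₀ k) →ₗ[k] (β →₀ k)} {s : Set α}
    {t : Set β} (h : ∀ a ∈ s, f (Finsupp.single a 1) ∈ Finsupp.supported k k t) {c : α →₀ k}
    (hc : c ∈ Finsupp.supported k k s) : f c ∈ Finsupp.supported k k t := by
  rw [Finsupp.supported_eq_span_single] at hc
  have : Submodule.span k ((fun i => Finsupp.single i 1) '' s) ≤
      (Finsupp.supported k k t).comap f := by
    rw [Submodule.span_le]
    rintro _ ⟨a, ha, rfl⟩
    exact h a ha
  exact this hc

variable {E : Type*} [NormedAddCommGroup E] [NormedSpace ℝ E] {S : Set E} [ConvexSet S]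

theorem dist_convComb_le {n : ℕ} (v : Fin (n + 1) → S) (w : stdSimplex ℝ (Fin (n + 1))) {q : S}
    {e : ℝ} (h : ∀ i, dist (v i) q ≤ e) : dist (convComb v w) q ≤ e := by
  have := (convex_closedBall (q : E) e).sum_mem (t := Finset.univ) (w := w)
    (z := fun i => (v i : E)) (fun i _ => w.2.1 i) w.2.2 fun i _ => h i
  exact this

/-- The vector from `v i` to the barycentre is the average of the `n + 1` vectors `v j - v i`, one
of which is zero; hence the factor `n / (n + 1)`. -/
theorem dist_tupleBary_le {n : ℕ} (v : Fin (n + 1) → S) {d : ℝ} (h : ∀ i j, dist (v i) (v j) ≤ d)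
    (i : Fin (n + 1)) : dist (v i) (tupleBary v) ≤ n / (n + 1) * d := by
  have hn : (0 : ℝ) < n + 1 := by positivity
  have h1 : (tupleBary v : E) - v i = ∑ j, ((n : ℝ) + 1)⁻¹ • ((v j : E) - v i) := by
    have hb (j : Fin (n + 1)) : (stdSimplex.barycenter : stdSimplex ℝ (Fin (n + 1))) j =
        ((n : ℝ) + 1)⁻¹ := by
      refine (stdSimplex.barycenter_apply (𝕜 := ℝ) j).trans ?_
      simp
    simp only [smul_sub, Finset.sum_sub_distrib, Finset.sum_const, Finset.card_univ,
      Fintype.card_fin, tupleBary, coe_convComb, hb]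
    rw [← Nat.cast_smul_eq_nsmul ℝ, smul_smul]
    push_cast
    rw [mul_inv_cancel₀ hn.ne', one_smul]
  rw [dist_comm, Subtype.dist_eq, dist_eq_norm, h1]
  refine (norm_sum_le _ _).trans ?_
  rw [← Finset.add_sum_erase _ _ (Finset.mem_univ i), sub_self, smul_zero, norm_zero, zero_add]
  refine (Finset.sum_le_card_nsmul _ _ (((n : ℝ) + 1)⁻¹ * d) fun j _ => ?_).trans ?_
  · rw [norm_smul, Real.norm_of_nonneg (by positivity), ← dist_eq_norm]
    exact mul_le_mul_of_nonneg_left (h j i) (by positivity)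
  · rw [Finset.card_erase_of_mem (Finset.mem_univ i), Finset.card_univ, Fintype.card_fin,
      Nat.add_sub_cancel, nsmul_eq_mul]
    apply le_of_eq
    ring

/-- `u` lies in every ball that contains `v`, and its diameter is smaller than that of `v` by
the factor `n / (n + 1)`. -/
def MeshRefines {n : ℕ} (v u : Fin (n + 1) → S) : Prop :=
  (∀ (q : S) (e : ℝ), (∀ i, dist (v i) q ≤ e) → ∀ i, dist (u i) q ≤ e) ∧
    ∀ d : ℝ, (∀ i j, dist (v i) (v j) ≤ d) → ∀ i j, dist (u i) (u j) ≤ n / (n + 1) * d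

/-- A simplex of the subdivision is the barycentre followed by a simplex `u` of the subdivision of a
face. Distances inside `u` are controlled by induction. Distances from `u` to the barycentre are
controlled by the ball condition in `MeshRefines`, since the vertices of the face lie in a ball
about the barycentre. -/
theorem tupleSd_single_mem_supported {n : ℕ} (v : Fin (n + 1) → S) :
    tupleSd k S n (Finsupp.single v 1) ∈ Finsupp.supported k k {u | MeshRefines v u} := by
  induction n with
  | zero =>
    refine Finsupp.single_mem_supported k _ ⟨fun q e h => h, fun d h i j => ?_⟩
    rw [Subsingleton.elim (α := Fin 1) i j, dist_self]
    simp
  | succ n ih =>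
    rw [tupleSd_succ_single]
    have h1 : tupleBoundary k S n (Finsupp.single v 1) ∈
        Finsupp.supported k k (Set.range fun i : Fin (n + 2) => v ∘ i.succAbove) := by
      rw [tupleBoundary_single]
      exact Submodule.sum_mem _ fun i _ => Finsupp.single_mem_supported k _ ⟨i, rfl⟩
    have h2 : tupleSd k S n (tupleBoundary k S n (Finsupp.single v 1)) ∈
        Finsupp.supported k k {u | ∃ i : Fin (n + 2), MeshRefines (v ∘ i.succAbove) u} := by
      refine Finsupp.map_mem_supported ?_ h1
      rintro _ ⟨i, rfl⟩
      have hsub : {u | MeshRefines (v ∘ i.succAbove) u} ⊆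
          {u | ∃ i : Fin (n + 2), MeshRefines (v ∘ i.succAbove) u} := fun u hu => ⟨i, hu⟩
      exact Finsupp.supported_mono hsub (ih (v ∘ i.succAbove))
    refine Finsupp.map_mem_supported ?_ h2
    rintro u ⟨i, hu1, hu2⟩
    rw [tupleCone_single]
    refine Finsupp.single_mem_supported k _ ⟨fun q e h j => ?_, fun d h => ?_⟩
    · refine Fin.cases ?_ (fun j => ?_) j
      · exact dist_convComb_le v _ h
      · exact hu1 q e (fun a => h _) j
    · have hd : 0 ≤ d := dist_nonneg.trans (h 0 0)
      have hb : ∀ j, dist (u j) (tupleBary v) ≤ ((n + 1 : ℕ) : ℝ) / ((n + 1 : ℕ) + 1) * d :=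
        hu1 _ _ fun a => dist_tupleBary_le v h _
      have hle : (n : ℝ) / (n + 1) * d ≤ ((n + 1 : ℕ) : ℝ) / ((n + 1 : ℕ) + 1) * d := by
        refine mul_le_mul_of_nonneg_right ?_ hd
        rw [div_le_div_iff₀ (by positivity) (by positivity)]
        push_cast
        nlinarith
      intro a b
      refine Fin.cases ?_ (fun a => ?_) a <;> refine Fin.cases ?_ (fun b => ?_) b
      · rw [dist_self]
        positivity
      · rw [dist_comm]
        exact hb b
      · exact hb a
      · exact (hu2 d (fun _ _ => h _ _) a b).trans hle

theorem tupleSd_pow_single_mem_supported {n : ℕ} (v : Fin (n + 1) → S) {d : ℝ}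
    (h : ∀ i j, dist (v i) (v j) ≤ d) (N : ℕ) :
    (tupleSd k S n ^ N) (Finsupp.single v 1) ∈ Finsupp.supported k k
      {u | ∀ i j, dist (u i) (u j) ≤ ((n : ℝ) / (n + 1)) ^ N * d} := by
  induction N with
  | zero =>
    rw [pow_zero (tupleSd k S n), Module.End.one_apply]
    exact Finsupp.single_mem_supported k _ fun i j => by simpa using h i j
  | succ N ih =>
    rw [pow_succ' (tupleSd k S n), Module.End.mul_apply]
    refine Finsupp.map_mem_supported (fun u hu => ?_) ih
    refine Finsupp.supported_mono (fun u' hu' => ?_) (tupleSd_single_mem_supported u)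
    rw [Set.mem_ofPred_eq, pow_succ', mul_assoc]
    exact hu'.2 _ hu

end Mesh

/-! ### Chains subordinate to an open cover -/

section SmallChains

variable (k : Type u) [Field k] {X : Type*} [TopologicalSpace X]

/-- Singular chains all of whose simplices lie in `A`. -/
def chainsIn (A : Set X) (n : ℕ) : Submodule k (SingChain k X n) :=
  Finsupp.supported k k {σ | ∀ w, σ w ∈ A}

/-- The inclusion of a subset as a continuous map. -/
def subtypeIncl (A : Set X) : C(A, X) := ⟨Subtype.val, continuous_subtype_val⟩

variable {k} {n : ℕ}

theorem chainsIn_eq_range (A : Set X) (n : ℕ) :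
    chainsIn k A n = LinearMap.range (singMap k (subtypeIncl A) n) := by
  apply le_antisymm
  · rw [chainsIn, Finsupp.supported_eq_span_single, Submodule.span_le]
    rintro _ ⟨σ, hσ, rfl⟩
    refine ⟨Finsupp.single ⟨fun w => ⟨σ w, hσ w⟩, by fun_prop⟩ 1, ?_⟩
    rw [singMap_single]
    rfl
  · rintro _ ⟨c, rfl⟩
    refine Finsupp.map_mem_supported (s := Set.univ) (fun σ _ => ?_) (by simp)
    rw [singMap_single]
    exact Finsupp.single_mem_supported k _ fun w => (σ w).2

theorem singMap_subtypeIncl_mem_chainsIn (A : Set X) (c : SingChain k A n) :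
    singMap k (subtypeIncl A) n c ∈ chainsIn k A n := by
  rw [chainsIn_eq_range]
  exact ⟨c, rfl⟩

theorem exists_singMap_eq {A : Set X} {c : SingChain k X n} (hc : c ∈ chainsIn k A n) :
    ∃ c', singMap k (subtypeIncl A) n c' = c := by
  rwa [chainsIn_eq_range] at hc

theorem singBoundary_mem_chainsIn {A : Set X} {c : SingChain k X (n + 1)}
    (hc : c ∈ chainsIn k A (n + 1)) : singBoundary k X n c ∈ chainsIn k A n := by
  obtain ⟨c, rfl⟩ := exists_singMap_eq hc
  rw [singBoundary_singMap]
  exact singMap_subtypeIncl_mem_chainsIn _ _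

theorem singSd_mem_chainsIn {A : Set X} {c : SingChain k X n}
    (hc : c ∈ chainsIn k A n) : singSd k X n c ∈ chainsIn k A n := by
  obtain ⟨c, rfl⟩ := exists_singMap_eq hc
  rw [singSd_singMap]
  exact singMap_subtypeIncl_mem_chainsIn _ _

theorem mem_chainsIn_inter {A B : Set X} {c : SingChain k X n} (hA : c ∈ chainsIn k A n)
    (hB : c ∈ chainsIn k B n) : c ∈ chainsIn k (A ∩ B) n :=
  fun _ hσ w => ⟨hA hσ w, hB hσ w⟩

theorem singSd_pow_mem_sup {A B : Set X} {c : SingChain k X n}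
    (hc : c ∈ chainsIn k A n ⊔ chainsIn k B n) (N : ℕ) :
    (singSd k X n ^ N) c ∈ chainsIn k A n ⊔ chainsIn k B n := by
  induction N with
  | zero => exact hc
  | succ N ih =>
    rw [pow_succ', Module.End.mul_apply]
    obtain ⟨a, ha, b, hb, h⟩ := Submodule.mem_sup.1 ih
    rw [← h, map_add]
    exact Submodule.add_mem_sup (singSd_mem_chainsIn ha) (singSd_mem_chainsIn hb)

theorem singSd_pow_applyTuple {E : Type*} [AddCommGroup E] [Module ℝ E] [TopologicalSpace E]
    [ContinuousAdd E] [ContinuousSMul ℝ E] {S : Set E} [ConvexSet S] (σ : C(S, X))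
    (c : TupleChain k S n) (N : ℕ) :
    (singSd k X n ^ N) (applyTuple k σ n c) = applyTuple k σ n ((tupleSd k S n ^ N) c) := by
  induction N with
  | zero => rfl
  | succ N ih => rw [pow_succ', pow_succ', Module.End.mul_apply, Module.End.mul_apply, ih,
      singSd_applyTuple]

/-- The pulled-back cover of the compact simplex has a Lebesgue number, and the mesh `(n / (n + 1))
^ N * d` tends to 0. -/
theorem exists_singSd_pow_single_mem_sup {A B : Set X} (hA : IsOpen A) (hB : IsOpen B)
    (hAB : A ∪ B = Set.univ) (σ : C(stdSimplex ℝ (Fin (n + 1)), X)) :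
    ∃ N, (singSd k X n ^ N) (Finsupp.single σ 1) ∈ chainsIn k A n ⊔ chainsIn k B n := by
  obtain ⟨δ, hδ, hball⟩ := lebesgue_number_lemma_of_metric
    (s := (Set.univ : Set (stdSimplex ℝ (Fin (n + 1))))) isCompact_univ
    (c := fun b : Bool => σ ⁻¹' (cond b A B))
    (fun b => (by cases b <;> assumption : IsOpen (cond b A B)).preimage σ.continuous)
    (fun x _ => by
      have : σ x ∈ A ∪ B := hAB ▸ Set.mem_univ _
      rcases this with h | h
      · exact Set.mem_iUnion.2 ⟨true, h⟩
      · exact Set.mem_iUnion.2 ⟨false, h⟩)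
  obtain ⟨d, hd⟩ : ∃ d : ℝ, ∀ i j, dist (stdTuple n i) (stdTuple n j) ≤ d :=
    ⟨Metric.diam (Set.univ : Set (stdSimplex ℝ (Fin (n + 1)))), fun i j =>
      Metric.dist_le_diam_of_mem isCompact_univ.isBounded (Set.mem_univ _) (Set.mem_univ _)⟩
  have hlim : Filter.Tendsto (fun N : ℕ => ((n : ℝ) / (n + 1)) ^ N * d) Filter.atTop (nhds 0) := by
    rw [← zero_mul d]
    refine (tendsto_pow_atTop_nhds_zero_of_lt_one (by positivity) ?_).mul_const d
    rw [div_lt_one (by positivity)]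
    linarith
  obtain ⟨N, hN⟩ := (hlim.eventually_lt_const hδ).exists
  refine ⟨N, ?_⟩
  rw [← applyTuple_stdTuple σ, singSd_pow_applyTuple]
  have h1 := tupleSd_pow_single_mem_supported (k := k) (stdTuple n) hd N
  rw [Finsupp.supported_eq_span_single] at h1
  have h2 : Submodule.span k ((fun u => Finsupp.single u (1 : k)) ''
      {u : Fin (n + 1) → stdSimplex ℝ (Fin (n + 1)) |
        ∀ i j, dist (u i) (u j) ≤ ((n : ℝ) / (n + 1)) ^ N * d}) ≤
      (chainsIn k A n ⊔ chainsIn k B n).comap (applyTuple k σ n) := by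
    rw [Submodule.span_le]
    rintro _ ⟨u, hu, rfl⟩
    change applyTuple k σ n (Finsupp.single u 1) ∈ chainsIn k A n ⊔ chainsIn k B n
    rw [applyTuple_single]
    -- The whole affine simplex lies in the `δ`-ball about its vertex `u 0`.
    obtain ⟨b, hb⟩ := hball (u 0) (Set.mem_univ _)
    have hin : ∀ w, σ (affineSimplex u w) ∈ cond b A B := fun w => by
      refine hb ?_
      rw [Metric.mem_ball]
      exact (dist_convComb_le u w fun i => hu i 0).trans_lt hN
    cases b
    · exact Submodule.mem_sup_right (Finsupp.single_mem_supported k _ hin)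
    · exact Submodule.mem_sup_left (Finsupp.single_mem_supported k _ hin)
  exact h2 h1

/-- The exponent depends on the simplex, but further subdivision keeps a chain small, so exponents
may be added. -/
theorem exists_singSd_pow_mem_sup {A B : Set X} (hA : IsOpen A) (hB : IsOpen B)
    (hAB : A ∪ B = Set.univ) (c : SingChain k X n) :
    ∃ N, (singSd k X n ^ N) c ∈ chainsIn k A n ⊔ chainsIn k B n := by
  induction c using Finsupp.induction_linear with
  | zero => exact ⟨0, by simp⟩
  | add x y hx hy =>
    obtain ⟨N, hN⟩ := hx
    obtain ⟨M, hM⟩ := hy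
    refine ⟨N + M, ?_⟩
    rw [map_add]
    refine Submodule.add_mem _ ?_ ?_
    · rw [add_comm N M, pow_add, Module.End.mul_apply]
      exact singSd_pow_mem_sup hN M
    · rw [pow_add, Module.End.mul_apply]
      exact singSd_pow_mem_sup hM N
  | single σ a =>
    obtain ⟨N, hN⟩ := exists_singSd_pow_single_mem_sup (k := k) hA hB hAB σ
    refine ⟨N, ?_⟩
    rw [← mul_one a, ← smul_eq_mul, ← Finsupp.smul_single, map_smul]
    exact Submodule.smul_mem _ _ hN

end SmallChains

/-! ### A Mayer-Vietoris inequality for doubles -/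

section OpenDouble

/-- A space `Z` covered by open sets `A` and `B`, each of which contains a copy of `D` that is
a retract of `Z`, and whose intersection retracts onto a copy of `L`; the copies of `L` are
deformed inside `A` and `B` into the copies of `D`, in a way the retraction does not distinguish. -/
structure OpenDouble (L D Z : Type) [TopologicalSpace L] [TopologicalSpace D]
    [TopologicalSpace Z] where
  /-- The first open set. -/
  A : Set Z
  /-- The second open set. -/
  B : Set Z
  isOpen_A : IsOpen A
  isOpen_B : IsOpen B
  union_eq : A ∪ B = Set.univ
  /-- The map from `L` to `D`. -/
  i : C(L, D)
  /-- The copy of `D` in `A`. -/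
  jA : C(D, A)
  /-- The copy of `D` in `B`. -/
  jB : C(D, B)
  /-- The retraction. -/
  r : C(Z, D)
  /-- The deformation in `A`. -/
  HA : C(L × unitInterval, A)
  /-- The deformation in `B`. -/
  HB : C(L × unitInterval, B)
  /-- The copy of `L` in the intersection. -/
  l : C(L, (A ∩ B : Set Z))
  /-- The retraction of the intersection. -/
  p : C((A ∩ B : Set Z), L)
  HA_one : HA.comp ⟨fun x => (x, 1), by fun_prop⟩ = jA.comp i
  HB_one : HB.comp ⟨fun x => (x, 1), by fun_prop⟩ = jB.comp i
  HA_zero : (subtypeIncl A).comp (HA.comp ⟨fun x => (x, 0), by fun_prop⟩) =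
    (subtypeIncl (A ∩ B)).comp l
  HB_zero : (subtypeIncl B).comp (HB.comp ⟨fun x => (x, 0), by fun_prop⟩) =
    (subtypeIncl (A ∩ B)).comp l
  p_l : p.comp l = ContinuousMap.id L
  r_jA : r.comp ((subtypeIncl A).comp jA) = ContinuousMap.id D
  r_jB : r.comp ((subtypeIncl B).comp jB) = ContinuousMap.id D
  r_H : r.comp ((subtypeIncl A).comp HA) = r.comp ((subtypeIncl B).comp HB)

namespace OpenDouble

variable {k : Type u} [Field k] {L D Z : Type} [TopologicalSpace L] [TopologicalSpace D]
  [TopologicalSpace Z] (P : OpenDouble L D Z) {n : ℕ}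

/-- A Mayer-Vietoris argument: if two chains in `A` and `B` with the same boundary in the
intersection are homologous in `Z` up to a cycle of `A`, then that boundary bounds
in the intersection. -/
theorem mem_singBoundaries_of_sub_eq {z : SingChain k L n} (hz : z ∈ singCycles k L n)
    {a b : SingChain k Z (n + 1)} (ha : a ∈ chainsIn k P.A (n + 1))
    (hb : b ∈ chainsIn k P.B (n + 1))
    (hb' : singBoundary k Z n b = singMap k ((subtypeIncl (P.A ∩ P.B)).comp P.l) n z)
    (e : SingChain k Z (n + 2)) (he : singBoundary k Z (n + 1) e = a - b) :
    z ∈ singBoundaries k L n := by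
  obtain ⟨N, hN⟩ := exists_singSd_pow_mem_sup P.isOpen_A P.isOpen_B P.union_eq e
  obtain ⟨eA, heA, eB, heB, hAB⟩ := Submodule.mem_sup.1 hN
  have hSA : (singSd k Z (n + 1) ^ N) a ∈ chainsIn k P.A (n + 1) := by
    obtain ⟨a', rfl⟩ := exists_singMap_eq ha
    rw [singSd_pow_singMap]
    exact singMap_subtypeIncl_mem_chainsIn _ _
  have hSB : (singSd k Z (n + 1) ^ N) b ∈ chainsIn k P.B (n + 1) := by
    obtain ⟨b', rfl⟩ := exists_singMap_eq hb
    rw [singSd_pow_singMap]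
    exact singMap_subtypeIncl_mem_chainsIn _ _
  have h1 : singBoundary k Z (n + 1) eA + singBoundary k Z (n + 1) eB =
      (singSd k Z (n + 1) ^ N) a - (singSd k Z (n + 1) ^ N) b := by
    rw [← map_add, hAB, singBoundary_singSd_pow, he, map_sub]
  -- The two expressions for `y` place it in `B` and in `A`, hence in the intersection; its boundary
  -- is that of the subdivided `b`.
  set y := (singSd k Z (n + 1) ^ N) b + singBoundary k Z (n + 1) eB with hy
  have hyA : y = (singSd k Z (n + 1) ^ N) a - singBoundary k Z (n + 1) eA := by
    rw [hy, eq_sub_iff_add_eq, add_assoc, add_comm (singBoundary k Z (n + 1) eB), h1]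
    abel
  have hyAB : y ∈ chainsIn k (P.A ∩ P.B) (n + 1) := by
    refine mem_chainsIn_inter ?_ ?_
    · rw [hyA]
      exact Submodule.sub_mem _ hSA (singBoundary_mem_chainsIn heA)
    · exact Submodule.add_mem _ hSB (singBoundary_mem_chainsIn heB)
  obtain ⟨y', hy'⟩ := exists_singMap_eq hyAB
  have h2 : singMap k (subtypeIncl (P.A ∩ P.B)) n (singBoundary k _ n y') =
      singMap k (subtypeIncl (P.A ∩ P.B)) n (singMap k P.l n ((singSd k L n ^ N) z)) := by
    rw [← singBoundary_singMap, hy', hy, map_add, singBoundary_singBoundary, add_zero,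
      singBoundary_singSd_pow, hb', singSd_pow_singMap, singMap_comp]
  have h3 := singMap_injective (f := subtypeIncl (P.A ∩ P.B)) Subtype.val_injective h2
  -- Pushed to `L` by `p`, the chain `y'` bounds a subdivision of `z`, which is homologous to `z`.
  have h4 : singBoundary k L n (singMap k P.p (n + 1) y') = (singSd k L n ^ N) z := by
    rw [singBoundary_singMap, h3, singMap_comp, P.p_l, singMap_id]
  have h5 := (sub_singSd_pow_mem_singBoundaries hz N).2
  rw [← sub_add_cancel z ((singSd k L n ^ N) z)]
  exact Submodule.add_mem _ h5 ⟨_, h4⟩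

variable (k n) in
/-- The cycles of `L` that bound in `D`. -/
def boundingCycles : Submodule k (SingChain k L n) :=
  singCycles k L n ⊓ (singBoundaries k D n).comap (singMap k P.i n)

/-- A filling in `D` of the image of `z` is placed in both halves and joined to the copy of `L` by
the prisms of `HA` and `HB`, so `a z - b z` is a cycle. The same filling serves both sides, hence
`r` does not distinguish `a z` from `b z`. -/
theorem exists_gluedCycle : ∃ a b : P.boundingCycles k n →ₗ[k] SingChain k Z (n + 1),
    (∀ z, a z ∈ chainsIn k P.A (n + 1)) ∧ (∀ z, b z ∈ chainsIn k P.B (n + 1)) ∧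
    (∀ z, singBoundary k Z n (a z) =
      singMap k ((subtypeIncl (P.A ∩ P.B)).comp P.l) n (z : SingChain k L n)) ∧
    (∀ z, singBoundary k Z n (b z) =
      singMap k ((subtypeIncl (P.A ∩ P.B)).comp P.l) n (z : SingChain k L n)) ∧
    ∀ z, singMap k P.r (n + 1) (a z) = singMap k P.r (n + 1) (b z) := by
  obtain ⟨t, ht⟩ := exists_lift_of_range_le k (singBoundary k D n)
    (singMap k P.i n ∘ₗ (P.boundingCycles k n).subtype) fun z => z.2.2
  simp only [LinearMap.comp_apply, Submodule.subtype_apply] at ht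
  let ι := (P.boundingCycles k n).subtype
  refine ⟨singMap k (subtypeIncl P.A) (n + 1) ∘ₗ
      (singMap k P.jA (n + 1) ∘ₗ t - singPrism k P.HA n ∘ₗ ι),
    singMap k (subtypeIncl P.B) (n + 1) ∘ₗ
      (singMap k P.jB (n + 1) ∘ₗ t - singPrism k P.HB n ∘ₗ ι),
    fun z => singMap_subtypeIncl_mem_chainsIn _ _, fun z => singMap_subtypeIncl_mem_chainsIn _ _,
    fun z => ?_, fun z => ?_, fun z => ?_⟩
  · simp only [LinearMap.comp_apply, LinearMap.sub_apply, ι, Submodule.subtype_apply]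
    rw [singBoundary_singMap, map_sub, singBoundary_singMap, ht,
      singBoundary_singPrism_of_mem_singCycles P.HA z.2.1, P.HA_one, singMap_comp,
      sub_sub_cancel, singMap_comp, P.HA_zero]
  · simp only [LinearMap.comp_apply, LinearMap.sub_apply, ι, Submodule.subtype_apply]
    rw [singBoundary_singMap, map_sub, singBoundary_singMap, ht,
      singBoundary_singPrism_of_mem_singCycles P.HB z.2.1, P.HB_one, singMap_comp,
      sub_sub_cancel, singMap_comp, P.HB_zero]
  · simp only [LinearMap.comp_apply, LinearMap.sub_apply, map_sub, singMap_singPrism, singMap_comp,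
      P.r_jA, P.r_jB, P.r_H]

/-- The glued cycles `a z - b z` are independent of the cycles `d` in the copy of `D` in `A`. If `a
z - b z + d` bounds, applying `r` cancels the glued part and shows that `d` bounds in `D`; since `a
z + d` lies in `A`, Mayer-Vietoris shows that `z` bounds in `L`. -/
theorem rank_ker_add_rank_le :
    Module.rank k (LinearMap.ker (singHomologyMap k P.i n)) +
      Module.rank k (SingHomology k D (n + 1)) ≤ Module.rank k (SingHomology k Z (n + 1)) := by
  obtain ⟨a, b, ha, hb, hda, hdb, hr⟩ := P.exists_gluedCycle (k := k) (n := n)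
  let j : C(D, Z) := (subtypeIncl P.A).comp P.jA
  let f₀ : P.boundingCycles k n × singCycles k D (n + 1) →ₗ[k] singCycles k Z (n + 1) :=
    ((a - b) ∘ₗ LinearMap.fst k _ _ +
      (singMap k j (n + 1) ∘ₗ (singCycles k D (n + 1)).subtype) ∘ₗ LinearMap.snd k _ _).codRestrict
      _ fun x => by
        refine Submodule.add_mem _ ?_ (singMap_mem_singCycles k j x.2.2)
        change singBoundary k Z n (a x.1 - b x.1) = 0
        rw [map_sub, hda, hdb, sub_self]
  let g₁ : P.boundingCycles k n →ₗ[k] LinearMap.ker (singHomologyMap k P.i n) :=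
    (singClass k L n ∘ₗ Submodule.inclusion inf_le_left).codRestrict _ fun z => by
      rw [LinearMap.mem_ker, LinearMap.comp_apply, singHomologyMap_singClass,
        singClass_eq_zero_iff]
      exact z.2.2
  let g := g₁.prodMap (singClass k D (n + 1))
  rw [← rank_prod']
  refine rank_le_of_surjective_of_ker_le k (singClass k Z (n + 1) ∘ₗ f₀) g ?_ ?_
  · rintro ⟨⟨x, hx⟩, y⟩
    obtain ⟨z, rfl⟩ := singClass_surjective n x
    obtain ⟨d, rfl⟩ := singClass_surjective (n + 1) y
    rw [LinearMap.mem_ker, singHomologyMap_singClass, singClass_eq_zero_iff] at hx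
    exact ⟨(⟨z, z.2, hx⟩, d), rfl⟩
  · rintro ⟨z, d⟩ h
    rw [LinearMap.comp_apply, singClass_eq_zero_iff] at h
    obtain ⟨e, he⟩ := h
    replace he : singBoundary k Z (n + 1) e =
      a z - b z + singMap k j (n + 1) (d : SingChain k D (n + 1)) := he
    refine Prod.ext ?_ ?_
    · refine Subtype.ext ?_
      change singClass k L n ⟨z, z.2.1⟩ = 0
      rw [singClass_eq_zero_iff]
      refine P.mem_singBoundaries_of_sub_eq z.2.1
        (a := a z + singMap k j (n + 1) (d : SingChain k D (n + 1))) (b := b z)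
        (Submodule.add_mem _ (ha z) ?_) (hb z) (hdb z) e ?_
      · rw [← singMap_comp]
        exact singMap_subtypeIncl_mem_chainsIn _ _
      · rw [he]
        abel
    · change singClass k D (n + 1) d = 0
      rw [singClass_eq_zero_iff]
      refine ⟨singMap k P.r (n + 2) e, ?_⟩
      rw [singBoundary_singMap, he, map_add, map_sub, hr, sub_self, zero_add, singMap_comp, P.r_jA,
        singMap_id]

-- Rank-nullity bounds `H_n(L)` by the kernel plus `H_n(D)`. The kernel in degree `n` is paired with
-- `H_{n+1}(D)`, so `H_0(D)` is split off and absorbed by `H_0(Z)`, of which it is a retract.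
variable (k) in
theorem totalHomologyDim_le (P : OpenDouble L D Z) :
    totalHomologyDim k L ≤ totalHomologyDim k Z := by
  unfold totalHomologyDim
  have h0 : Module.rank k (SingHomology k D 0) ≤ Module.rank k (SingHomology k Z 0) :=
    rank_singHomology_le_of_retract k _ _ P.r_jA 0
  calc Cardinal.sum (fun n => Module.rank k (SingHomology k L n))
      ≤ Cardinal.sum (fun n => Module.rank k (LinearMap.ker (singHomologyMap k P.i n)) +
          Module.rank k (SingHomology k D n)) := by
        refine Cardinal.sum_le_sum _ _ fun n => ?_
        rw [← LinearMap.rank_range_add_rank_ker (singHomologyMap k P.i n), add_comm]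
        gcongr
        exact Submodule.rank_le _
    _ = Module.rank k (SingHomology k D 0) +
        Cardinal.sum (fun n => Module.rank k (LinearMap.ker (singHomologyMap k P.i n)) +
          Module.rank k (SingHomology k D (n + 1))) := by
        have hadd (f g : ℕ → Cardinal.{u}) : Cardinal.sum (fun n => f n + g n) =
          Cardinal.sum f + Cardinal.sum g := Cardinal.sum_add_distrib f g
        rw [hadd, hadd, Cardinal.sum_nat_eq_add_sum_succ fun n => Module.rank k (SingHomology k D n)]
        ring
    _ ≤ Module.rank k (SingHomology k Z 0) +
        Cardinal.sum (fun n => Module.rank k (SingHomology k Z (n + 1))) :=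
        add_le_add h0 (Cardinal.sum_le_sum _ _ fun n => P.rank_ker_add_rank_le)
    _ = _ := (Cardinal.sum_nat_eq_add_sum_succ fun n => Module.rank k (SingHomology k Z n)).symm

end OpenDouble

end OpenDouble

/-! ### Coordinate slices as doubles -/

section Slices

variable {V : Type} [DecidableEq V]

/-- A subset `Z` of `ℝ^V` with suitable stability under changes of the coordinate `v` is the double
of its slice `x v = 1` along its slice `x v = 0`. -/
def sliceOpenDouble (Z : Set (V → ℝ)) (v : V)
    (h1 : ∀ x ∈ Z, ∀ t : ℝ, |t| = 1 → Function.update x v t ∈ Z)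
    (h2 : ∀ x ∈ Z, |x v| < 1 → ∀ t : ℝ, |t| ≤ 1 → Function.update x v t ∈ Z) :
    OpenDouble {x | x ∈ Z ∧ x v = 0} {x | x ∈ Z ∧ x v = 1} Z where
  A := {x | -1 < x.1 v}
  B := {x | x.1 v < 1}
  isOpen_A := isOpen_lt continuous_const ((continuous_apply v).comp continuous_subtype_val)
  isOpen_B := isOpen_lt ((continuous_apply v).comp continuous_subtype_val) continuous_const
  union_eq := by
    refine Set.eq_univ_of_forall fun x => ?_
    rcases lt_or_ge (-1) (x.1 v) with h | h
    · exact Or.inl h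
    · exact Or.inr (lt_of_le_of_lt h (by norm_num))
  i := ⟨fun x => ⟨Function.update x.1 v 1, h1 _ x.2.1 _ (by simp), by simp⟩, by fun_prop⟩
  jA := ⟨fun x => ⟨⟨x.1, x.2.1⟩, by
    change -1 < x.1 v
    rw [x.2.2]; norm_num⟩, by fun_prop⟩
  jB := ⟨fun x => ⟨⟨Function.update x.1 v (-1), h1 _ x.2.1 _ (by simp)⟩, by
    change Function.update x.1 v (-1) v < 1
    rw [Function.update_self]; norm_num⟩, by fun_prop⟩
  r := ⟨fun x => ⟨Function.update x.1 v 1, h1 _ x.2 _ (by simp), by simp⟩, by fun_prop⟩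
  -- The coordinate `v` moves from 0 to 1 here and from 0 to -1 in `HB`; `r` resets it to 1 in both
  -- cases.
  HA := ⟨fun x => ⟨⟨Function.update x.1.1 v x.2,
      h2 _ x.1.2.1 (by rw [x.1.2.2]; simp) _ (abs_le.2 ⟨by linarith [x.2.2.1], x.2.2.2⟩)⟩, by
    change -1 < Function.update x.1.1 v (x.2 : ℝ) v
    rw [Function.update_self]; linarith [x.2.2.1]⟩, by fun_prop⟩
  HB := ⟨fun x => ⟨⟨Function.update x.1.1 v (-x.2),
      h2 _ x.1.2.1 (by rw [x.1.2.2]; simp) _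
        (by rw [abs_neg]; exact abs_le.2 ⟨by linarith [x.2.2.1], x.2.2.2⟩)⟩, by
    change Function.update x.1.1 v (-x.2 : ℝ) v < 1
    rw [Function.update_self]; linarith [x.2.2.1]⟩, by fun_prop⟩
  l := ⟨fun x => ⟨⟨x.1, x.2.1⟩, by
    constructor
    · change -1 < x.1 v
      rw [x.2.2]; norm_num
    · change x.1 v < 1
      rw [x.2.2]; norm_num⟩, by fun_prop⟩
  -- On the intersection `|x v| < 1`, which is the condition under which `h2` frees the coordinate.
  p := ⟨fun x => ⟨Function.update x.1.1 v 0, h2 _ x.1.2 (abs_lt.2 x.2) _ (by simp), by simp⟩,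
    by fun_prop⟩
  HA_one := rfl
  HB_one := by
    ext x i
    change Function.update x.1 v (-1) i = Function.update (Function.update x.1 v 1) v (-1) i
    simp
  HA_zero := by
    ext x i
    change Function.update x.1 v 0 i = x.1 i
    exact congrFun (Function.update_eq_self_iff.2 x.2.2.symm) i
  HB_zero := by
    ext x i
    change Function.update x.1 v (-0) i = x.1 i
    rw [neg_zero]
    exact congrFun (Function.update_eq_self_iff.2 x.2.2.symm) i
  p_l := by
    ext x i
    change Function.update x.1 v 0 i = x.1 i
    exact congrFun (Function.update_eq_self_iff.2 x.2.2.symm) i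
  r_jA := by
    ext x i
    change Function.update x.1 v 1 i = x.1 i
    exact congrFun (Function.update_eq_self_iff.2 x.2.2.symm) i
  r_jB := by
    ext x i
    change Function.update (Function.update x.1 v (-1)) v 1 i = x.1 i
    rw [Function.update_idem]
    exact congrFun (Function.update_eq_self_iff.2 x.2.2.symm) i
  r_H := by
    ext x i
    change Function.update (Function.update x.1.1 v x.2) v 1 i =
      Function.update (Function.update x.1.1 v (-x.2)) v 1 i
    simp

end Slices

/-! ### A lower bound for zeroth homology -/

section HomologyZero

variable (k : Type u) [Field k]

/-- A continuous map to a discrete space is constant along each singular 1-simplex, so the induced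
map on 0-chains kills boundaries. -/
theorem mk_le_rank_singHomology_zero {X ι : Type} [TopologicalSpace X] [TopologicalSpace ι]
    [DiscreteTopology ι] (g : C(X, ι)) (hg : Function.Surjective g) :
    Cardinal.lift.{u} (Cardinal.mk ι) ≤ Module.rank k (SingHomology k X 0) := by
  let q : SingChain k X 0 →ₗ[k] (ι →₀ k) :=
    Finsupp.lmapDomain k k fun σ => g (σ (stdSimplex.vertex 0))
  have hq : Function.Surjective q := by
    refine Finsupp.mapDomain_surjective fun i => ?_
    obtain ⟨x, rfl⟩ := hg i
    exact ⟨ContinuousMap.const _ x, rfl⟩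
  have hq' (c : SingChain k X 1) : q (singBoundary k X 0 c) = 0 := by
    refine SingChain.linearMap_ext (f := q ∘ₗ singBoundary k X 0) (g := 0) (fun σ => ?_) c
    have hconst (w w' : stdSimplex ℝ (Fin 2)) : g (σ w) = g (σ w') :=
      PreconnectedSpace.constant inferInstance (f := g.comp σ) (g.comp σ).continuous
    rw [LinearMap.comp_apply, singBoundary, altBoundary_single, Fin.sum_univ_two, map_add]
    simp only [q, Finsupp.lmapDomain_apply, Finsupp.mapDomain_single, ContinuousMap.comp_apply]
    rw [hconst _ (simplexFace 1 (stdSimplex.vertex 0)), ← Finsupp.single_add]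
    simp
  have h := rank_le_of_surjective_of_ker_le k (singClass k X 0)
    (q ∘ₗ (singCycles k X 0).subtype) (fun y => ?_) (fun c hc => ?_)
  · rwa [rank_finsupp_self] at h
  · obtain ⟨c, rfl⟩ := hq y
    exact ⟨⟨c, trivial⟩, rfl⟩
  · rw [singClass_eq_zero_iff] at hc
    obtain ⟨b, hb⟩ := hc
    change q c = 0
    rw [← hb, hq']

end HomologyZero

/-! ### Real polyhedral products and their vanishing slices -/

section RealPolyhedralProduct

variable {V : Type}

/-- The polyhedral product of `(D¹, S⁰)` for a family of finite sets of vertices. -/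
def cubeProduct (F : Set (Finset V)) : Set (V → ℝ) :=
  {x | ∃ σ ∈ F, ∀ i, |x i| ≤ 1 ∧ (i ∉ σ → |x i| = 1)}

/-- The slice of `cubeProduct F` where the coordinates in `τ` vanish. -/
def cubeSlice (F : Set (Finset V)) (τ : Finset V) : Set (V → ℝ) :=
  {x | x ∈ cubeProduct F ∧ ∀ i ∈ τ, x i = 0}

variable (k : Type u) [Field k] (F : Set (Finset V))

/-- Giving the coordinate `v` modulus 1 never leaves the face; and `|x v| < 1` forces `v` to belong
to the face, where the coordinate is free. As `v ∉ τ`, the vanishing conditions are not disturbed.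
-/
theorem totalHomologyDim_cubeSlice_insert_le [DecidableEq V] (τ : Finset V) {v : V} (hv : v ∉ τ) :
    totalHomologyDim k (cubeSlice F (insert v τ)) ≤ totalHomologyDim k (cubeSlice F τ) := by
  have h : cubeSlice F (insert v τ) = {x | x ∈ cubeSlice F τ ∧ x v = 0} := by
    ext x
    simp only [cubeSlice, Set.mem_ofPred_eq, Finset.forall_mem_insert]
    tauto
  rw [h]
  refine (sliceOpenDouble (cubeSlice F τ) v ?_ ?_).totalHomologyDim_le k
  · rintro x ⟨⟨σ, hσ, hx⟩, h0⟩ t ht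
    refine ⟨⟨σ, hσ, fun i => ?_⟩, fun i hi => ?_⟩
    · rcases eq_or_ne i v with rfl | hi
      · simp [ht]
      · rw [Function.update_of_ne hi]
        exact hx i
    · rw [Function.update_of_ne (by rintro rfl; exact hv hi)]
      exact h0 i hi
  · rintro x ⟨⟨σ, hσ, hx⟩, h0⟩ hxv t ht
    refine ⟨⟨σ, hσ, fun i => ?_⟩, fun i hi => ?_⟩
    · rcases eq_or_ne i v with rfl | hi
      · rw [Function.update_self]
        refine ⟨ht, fun hi => ?_⟩
        exact absurd ((hx i).2 hi) hxv.ne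
      · rw [Function.update_of_ne hi]
        exact hx i
    · rw [Function.update_of_ne (by rintro rfl; exact hv hi)]
      exact h0 i hi

theorem totalHomologyDim_cubeSlice_le (τ : Finset V) :
    totalHomologyDim k (cubeSlice F τ) ≤ totalHomologyDim k (cubeProduct F) := by
  classical
  induction τ using Finset.induction_on with
  | empty =>
    have : cubeSlice F ∅ = cubeProduct F := by
      ext x
      simp [cubeSlice]
    rw [this]
  | insert v τ hv ih => exact (totalHomologyDim_cubeSlice_insert_le k F τ hv).trans ih

variable {F} [Fintype V] [DecidableEq V]

/-- A point vanishing on `σ` needs a face containing `σ`, hence `σ` itself, so its other coordinates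
are `±1`. Their sign vector is continuous and takes all values. -/
theorem two_pow_le_totalHomologyDim_cubeSlice {σ : Finset V} (hσ : σ ∈ F)
    (hmax : ∀ ρ ∈ F, σ ⊆ ρ → ρ = σ) :
    (2 : Cardinal.{u}) ^ (σᶜ).card ≤ totalHomologyDim k (cubeSlice F σ) := by
  have habs (x : cubeSlice F σ) (i : V) (hi : i ∉ σ) : |x.1 i| = 1 := by
    obtain ⟨⟨ρ, hρ, hx⟩, h0⟩ := x.2
    have hsub : σ ⊆ ρ := fun j hj => by
      by_contra hj'
      have := (hx j).2 hj'
      rw [h0 j hj] at this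
      simp at this
    rw [hmax ρ hρ hsub] at hx
    exact (hx i).2 hi
  let g : C(cubeSlice F σ, {i // i ∉ σ} → Bool) :=
    ⟨fun x i => decide (0 < x.1 i), by
      refine continuous_pi fun i => ?_
      have hev : Continuous fun x : cubeSlice F σ => x.1 i :=
        (continuous_apply i.1).comp continuous_subtype_val
      rw [continuous_bool_rng true]
      have : (fun x : cubeSlice F σ => decide (0 < x.1 i)) ⁻¹' {true} = {x | 0 < x.1 i} := by
        ext x
        simp
      rw [this]
      refine ⟨?_, isOpen_lt continuous_const hev⟩
      -- Since the coordinate is `±1`, being positive is also a closed condition.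
      have h2 : {x : cubeSlice F σ | 0 < x.1 i} = {x | 1 ≤ x.1 i} := by
        ext x
        simp only [Set.mem_ofPred_eq]
        constructor
        · intro h
          have := habs x i i.2
          rw [abs_of_pos h] at this
          exact this.ge
        · intro h
          linarith
      rw [h2]
      exact isClosed_le continuous_const hev⟩
  have hg : Function.Surjective g := fun b => by
    refine ⟨⟨fun i => if h : i ∈ σ then 0 else if b ⟨i, h⟩ then 1 else -1,
      ⟨σ, hσ, fun i => ?_⟩, fun i hi => by simp [hi]⟩, ?_⟩
    · by_cases hi : i ∈ σ
      · simp [hi]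
      · by_cases hb : b ⟨i, hi⟩ <;> simp [hi, hb]
    · funext i
      change decide (0 < (if h : i.1 ∈ σ then (0 : ℝ) else if b ⟨i, h⟩ then 1 else -1)) = b i
      rw [dif_neg i.2]
      by_cases hb : b i <;> simp [hb]
  have h := mk_le_rank_singHomology_zero k g hg
  have hcard : Fintype.card {i // i ∉ σ} = (σᶜ).card := by
    rw [Fintype.card_subtype]
    congr 1
    ext i
    simp
  have h2 : Cardinal.lift.{u} (Cardinal.mk ({i // i ∉ σ} → Bool)) = 2 ^ (σᶜ).card := by
    rw [Cardinal.mk_fintype, Fintype.card_fun, hcard, Fintype.card_bool, Cardinal.lift_natCast,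
      Nat.cast_pow, Nat.cast_ofNat]
  rw [h2] at h
  exact h.trans (Cardinal.le_sum (fun n => Module.rank k (SingHomology k (cubeSlice F σ) n)) 0)

theorem two_pow_le_totalHomologyDim_cubeProduct {σ : Finset V} (hσ : σ ∈ F)
    (hmax : ∀ ρ ∈ F, σ ⊆ ρ → ρ = σ) :
    (2 : Cardinal.{u}) ^ (σᶜ).card ≤ totalHomologyDim k (cubeProduct F) :=
  (two_pow_le_totalHomologyDim_cubeSlice k hσ hmax).trans (totalHomologyDim_cubeSlice_le k F σ)

end RealPolyhedralProduct

/-! ### The disc and the square -/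

section DiscSquare

/-- The norm of `ℝ × ℝ` is the maximum norm, whose unit ball is the square. The Euclidean disc is
bounded and convex with nonempty interior, so an ambient homeomorphism carries it and its frontier
to this ball and its sphere. -/
theorem exists_homeomorph_disc_square : ∃ g : ℂ ≃ₜ ℝ × ℝ,
    (∀ z, ‖g z‖ ≤ 1 ↔ ‖z‖ ≤ 1) ∧ ∀ z, ‖g z‖ = 1 ↔ ‖z‖ = 1 := by
  let e : ℂ ≃L[ℝ] ℝ × ℝ := Complex.equivRealProdCLM
  let s : Set (ℝ × ℝ) := e '' Metric.closedBall 0 1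
  have hint : interior s = e '' Metric.ball 0 1 := by
    rw [← interior_closedBall (0 : ℂ) one_ne_zero]
    exact (e.toHomeomorph.image_interior _).symm
  obtain ⟨h, -, hcl, hfr⟩ := exists_homeomorph_image_interior_closure_frontier_eq_unitBall (s := s)
    ((convex_closedBall (0 : ℂ) 1).linear_image e.toLinearMap)
    (by rw [hint]; exact ⟨e 0, 0, by simp, rfl⟩)
    ((e : ℂ →L[ℝ] ℝ × ℝ).lipschitz.isBounded_image Metric.isBounded_closedBall)
  have h1 : closure s = e '' Metric.closedBall 0 1 := by
    refine (e.toHomeomorph.image_closure _).symm.trans ?_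
    rw [Metric.isClosed_closedBall.closure_eq]
    rfl
  have h2 : frontier s = e '' Metric.sphere 0 1 := by
    rw [← frontier_closedBall (0 : ℂ) one_ne_zero]
    exact (e.toHomeomorph.image_frontier _).symm
  rw [h1] at hcl
  rw [h2] at hfr
  refine ⟨e.toHomeomorph.trans h, fun z => ?_, fun z => ?_⟩
  · rw [← mem_closedBall_zero_iff, ← mem_closedBall_zero_iff, ← hcl]
    change h (e z) ∈ _ ↔ _
    rw [h.injective.mem_set_image, e.injective.mem_set_image]
  · rw [← mem_sphere_zero_iff_norm, ← mem_sphere_zero_iff_norm, ← hfr]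
    change h (e z) ∈ _ ↔ _
    rw [h.injective.mem_set_image, e.injective.mem_set_image]

end DiscSquare

/-! ### Moment-angle complexes as real polyhedral products -/

section MomentAngle

variable {m : ℕ}

theorem mem_polyhedralProduct_iff {E : Type*} [SeminormedAddCommGroup E]
    (K : PreAbstractSimplicialComplex (Fin m)) (z : Fin m → E) :
    z ∈ polyhedralProduct K (Metric.closedBall 0 1) (Metric.sphere 0 1) ↔
      ∃ σ ∈ insert ∅ K.faces, ∀ i, ‖z i‖ ≤ 1 ∧ (i ∉ σ → ‖z i‖ = 1) := by
  simp only [polyhedralProduct, Set.mem_iUnion, Set.mem_ofPred_eq, exists_prop,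
    mem_closedBall_zero_iff, mem_sphere_zero_iff_norm]
  refine exists_congr fun σ => and_congr_right fun _ => forall_congr' fun i => ?_
  by_cases hi : i ∈ σ
  · simp [hi]
  · simp only [hi, not_false_eq_true, forall_true_left, IsEmpty.forall_iff, true_and]
    exact ⟨fun h => ⟨h.le, h⟩, fun h => h.2⟩

theorem exists_maximal_face (K : PreAbstractSimplicialComplex (Fin m)) :
    ∃ σ ∈ insert ∅ K.faces, ∀ ρ ∈ insert ∅ K.faces, σ ⊆ ρ → ρ = σ := by
  obtain ⟨σ, hσ⟩ := (Set.toFinite (insert ∅ K.faces)).exists_maximal ⟨∅, Set.mem_insert _ _⟩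
  exact ⟨σ, hσ.1, fun ρ hρ h => (hσ.2 hρ h).antisymm h⟩

theorem realMomentAngle_eq_cubeProduct (K : PreAbstractSimplicialComplex (Fin m)) :
    realMomentAngle K = cubeProduct (insert ∅ K.faces) := by
  ext x
  exact mem_polyhedralProduct_iff K x

/-- The family of vertex sets on two copies of `[m]` whose full pairs form a member of `F`. -/
def doubledFamily (F : Set (Finset (Fin m))) : Set (Finset (Fin m × Fin 2)) :=
  {τ | ∃ σ ∈ F, ∀ i, (i, 0) ∈ τ → (i, 1) ∈ τ → i ∈ σ}

variable (k : Type u) [Field k]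

/-- A point of the square is on the boundary when one of its two coordinates has modulus 1, so a
pair of vertices is fully free only over `σ`: this is `doubledFamily`. The maps given by `g` are
mutually inverse, but a retraction suffices. -/
theorem totalHomologyDim_cubeProduct_le_momentAngle (K : PreAbstractSimplicialComplex (Fin m)) :
    totalHomologyDim k (cubeProduct (doubledFamily (insert ∅ K.faces))) ≤
      totalHomologyDim k (momentAngle K) := by
  obtain ⟨g, hg1, hg2⟩ := exists_homeomorph_disc_square
  have hle (p : ℝ × ℝ) : ‖p‖ ≤ 1 ↔ |p.1| ≤ 1 ∧ |p.2| ≤ 1 := by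
    rw [Prod.norm_def, max_le_iff, Real.norm_eq_abs, Real.norm_eq_abs]
  have heq (p : ℝ × ℝ) : ‖p‖ = 1 ↔ (|p.1| ≤ 1 ∧ |p.2| ≤ 1) ∧ (|p.1| = 1 ∨ |p.2| = 1) := by
    rw [Prod.norm_def, Real.norm_eq_abs, Real.norm_eq_abs]
    constructor
    · intro h
      refine ⟨⟨h ▸ le_max_left _ _, h ▸ le_max_right _ _⟩, ?_⟩
      rcases max_choice |p.1| |p.2| with h' | h' <;> rw [h'] at h <;> simp [h]
    · rintro ⟨⟨h1, h2⟩, h | h⟩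
      · rw [h, max_eq_left h2]
      · rw [h, max_eq_right h1]
  have hf (y : cubeProduct (doubledFamily (insert ∅ K.faces))) :
      (fun i => g.symm (y.1 (i, 0), y.1 (i, 1))) ∈ momentAngle K := by
    obtain ⟨τ, ⟨σ, hσ, hτ⟩, hy⟩ := y.2
    refine (mem_polyhedralProduct_iff K _).2 ⟨σ, hσ, fun i => ⟨?_, fun hi => ?_⟩⟩
    · rw [← hg1, g.apply_symm_apply, hle]
      exact ⟨(hy _).1, (hy _).1⟩
    · rw [← hg2, g.apply_symm_apply, heq]
      refine ⟨⟨(hy _).1, (hy _).1⟩, ?_⟩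
      by_contra! h
      exact hi (hτ i (by_contra fun h' => h.1 ((hy _).2 h'))
        (by_contra fun h' => h.2 ((hy _).2 h')))
  have hf' (z : momentAngle K) :
      (fun p : Fin m × Fin 2 => if p.2 = 0 then (g (z.1 p.1)).1 else (g (z.1 p.1)).2) ∈
        cubeProduct (doubledFamily (insert ∅ K.faces)) := by
    obtain ⟨σ, hσ, hz⟩ := (mem_polyhedralProduct_iff K _).1 z.2
    classical
    -- The witnessing face is the smallest possible: the coordinates whose modulus is not 1.
    refine ⟨Finset.univ.filter fun p : Fin m × Fin 2 =>
      |if p.2 = 0 then (g (z.1 p.1)).1 else (g (z.1 p.1)).2| ≠ 1, ⟨σ, hσ, fun i h0 h1 => ?_⟩,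
      fun p => ⟨?_, fun hp => ?_⟩⟩
    · simp only [Finset.mem_filter, Finset.mem_univ, true_and, if_true, one_ne_zero, if_false,
        Fin.isValue] at h0 h1
      by_contra hi
      rcases ((heq _).1 ((hg2 _).2 ((hz i).2 hi))).2 with h | h
      · exact h0 h
      · exact h1 h
    · have := (hle _).1 ((hg1 _).2 (hz p.1).1)
      dsimp only
      split_ifs
      · exact this.1
      · exact this.2
    · simpa using hp
  have hc : Continuous fun y : cubeProduct (doubledFamily (insert ∅ K.faces)) =>
      (⟨_, hf y⟩ : momentAngle K) := by
    refine Continuous.subtype_mk (continuous_pi fun i => g.symm.continuous.comp ?_) _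
    exact ((continuous_apply _).comp continuous_subtype_val).prodMk
      ((continuous_apply _).comp continuous_subtype_val)
  have hc' : Continuous fun z : momentAngle K =>
      (⟨_, hf' z⟩ : cubeProduct (doubledFamily (insert ∅ K.faces))) := by
    refine Continuous.subtype_mk (continuous_pi fun p => ?_) _
    have hg : Continuous fun z : momentAngle K => g (z.1 p.1) :=
      g.continuous.comp ((continuous_apply _).comp continuous_subtype_val)
    split_ifs
    · exact continuous_fst.comp hg
    · exact continuous_snd.comp hg
  refine totalHomologyDim_le_of_retract k ⟨_, hc⟩ ⟨_, hc'⟩ ?_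
  ext y ⟨i, j⟩
  fin_cases j <;> simp

theorem two_pow_le_totalHomologyDim_realMomentAngle (K : PreAbstractSimplicialComplex (Fin m))
    {σ : Finset (Fin m)} (hσ : σ ∈ insert ∅ K.faces)
    (hmax : ∀ ρ ∈ insert ∅ K.faces, σ ⊆ ρ → ρ = σ) :
    (2 : Cardinal.{u}) ^ (σᶜ).card ≤ totalHomologyDim k (realMomentAngle K) := by
  rw [realMomentAngle_eq_cubeProduct]
  exact two_pow_le_totalHomologyDim_cubeProduct k hσ hmax

theorem two_pow_le_totalHomologyDim_momentAngle (K : PreAbstractSimplicialComplex (Fin m))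
    {σ : Finset (Fin m)} (hσ : σ ∈ insert ∅ K.faces)
    (hmax : ∀ ρ ∈ insert ∅ K.faces, σ ⊆ ρ → ρ = σ) :
    (2 : Cardinal.{u}) ^ (σᶜ).card ≤ totalHomologyDim k (momentAngle K) := by
  -- All first copies, and the second copies over `σ` only. Adding `(i, 1)` with `i ∉ σ` would
  -- complete a pair outside `σ`, so `τ` is maximal, and its complement is a copy of `σᶜ`.
  let τ : Finset (Fin m × Fin 2) := Finset.univ.filter fun p => p.1 ∈ σ ∨ p.2 = 0
  have hcard : (σᶜ).card = (τᶜ).card := by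
    refine Finset.card_bij (fun i _ => (i, 1)) ?_ ?_ ?_
    · intro i hi
      simpa [τ] using hi
    · intro i _ j _ h
      exact congrArg Prod.fst h
    · rintro ⟨i, j⟩ h
      simp only [τ, Finset.mem_compl, Finset.mem_filter, Finset.mem_univ, true_and,
        not_or] at h
      refine ⟨i, by simpa using h.1, ?_⟩
      have : j = 1 := by
        have := h.2
        omega
      rw [this]
  rw [hcard]
  refine (two_pow_le_totalHomologyDim_cubeProduct k (F := doubledFamily (insert ∅ K.faces))
    (σ := τ) ⟨σ, hσ, fun i _ h1 => by simpa [τ] using h1⟩ ?_).trans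
    (totalHomologyDim_cubeProduct_le_momentAngle k K)
  rintro ρ ⟨σ', hσ', hρ⟩ hτρ
  have h0 (i : Fin m) : (i, 0) ∈ ρ := hτρ (by simp [τ])
  have hs : σ' = σ := hmax σ' hσ' fun i hi => hρ i (h0 i) (hτρ (by simp [τ, hi]))
  refine subset_antisymm ?_ hτρ
  rintro ⟨i, j⟩ hij
  have hj : j = 0 ∨ j = 1 := by omega
  rcases hj with rfl | rfl
  · simp [τ]
  · have := hρ i (h0 i) hij
    rw [hs] at this
    simp [τ, this]

end MomentAngle

/-! ### Free actions and the bound on the rank -/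

section FreeActions

variable {m r : ℕ}

/-- The point with coordinates 0 on `σ` and 1 elsewhere is fixed by such an `h`. -/
theorem eq_one_of_free_realMomentAngle (K : PreAbstractSimplicialComplex (Fin m))
    {σ : Finset (Fin m)} (hσ : σ ∈ insert ∅ K.faces) (H : Subgroup (Fin m → ℤˣ))
    (hfree : ∀ (h : H) (x : realMomentAngle K), h • x = x → h = 1) (h : H)
    (hh : ∀ i ∉ σ, h.1 i = 1) : h = 1 := by
  classical
  let x : Fin m → ℝ := fun i => if i ∈ σ then 0 else 1
  have hx : x ∈ realMomentAngle K := (mem_polyhedralProduct_iff K _).2 ⟨σ, hσ, fun i => by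
    by_cases hi : i ∈ σ <;> simp [x, hi]⟩
  refine hfree h ⟨x, hx⟩ (Subtype.ext (funext fun i => ?_))
  change h.1 i • x i = x i
  by_cases hi : i ∈ σ
  · simp [x, hi]
  · rw [hh i hi, one_smul]

theorem eq_one_of_free_momentAngle (K : PreAbstractSimplicialComplex (Fin m))
    {σ : Finset (Fin m)} (hσ : σ ∈ insert ∅ K.faces) (H : Subgroup (Fin m → Circle))
    (hfree : ∀ (h : H) (x : momentAngle K), h • x = x → h = 1) (h : H)
    (hh : ∀ i ∉ σ, h.1 i = 1) : h = 1 := by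
  classical
  let x : Fin m → ℂ := fun i => if i ∈ σ then 0 else 1
  have hx : x ∈ momentAngle K := (mem_polyhedralProduct_iff K _).2 ⟨σ, hσ, fun i => by
    by_cases hi : i ∈ σ <;> simp [x, hi]⟩
  refine hfree h ⟨x, hx⟩ (Subtype.ext (funext fun i => ?_))
  change h.1 i • x i = x i
  by_cases hi : i ∈ σ
  · simp [x, hi]
  · rw [hh i hi, one_smul]

/-- A group containing `(ℤ/2)^r` that is detected by `m` coordinates with at most one
nontrivial involution each has `r ≤ m`. -/
theorem le_card_of_injective {G : Type*} [Group G] (hG : ∀ a b : G, a ^ 2 = 1 → b ^ 2 = 1 →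
    a ≠ 1 → b ≠ 1 → a = b) (c : G) (hc : c ^ 2 = 1) (hc1 : c ≠ 1) {ι : Type*} (s : Finset ι)
    (H : Subgroup (ι → G)) (e : H ≃* (Fin r → G))
    (hH : ∀ h : H, (∀ i ∈ s, h.1 i = 1) → h = 1) : r ≤ s.card := by
  classical
  -- These are `2^r` distinct elements of `H` whose square is 1.
  let φ : (Fin r → Bool) → H := fun b => e.symm fun j => if b j then c else 1
  have hφ : Function.Injective φ := by
    intro b b' h
    have h' := e.symm.injective h
    funext j
    have := congrFun h' j
    cases hb : b j <;> cases hb' : b' j <;> simp only [hb, hb', if_true, Bool.false_eq_true,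
      if_false] at this ⊢
    · exact absurd this.symm hc1
    · exact absurd this hc1
  have hφ2 (b : Fin r → Bool) : φ b ^ 2 = 1 := by
    rw [← map_pow, MulEquiv.map_eq_one_iff]
    funext j
    by_cases hb : b j <;> simp [hb, hc]
  -- A coordinate squaring to 1 has at most one nontrivial value, so the set of trivial coordinates
  -- in `s` determines the element on `s`, and then `hH` determines it entirely. Hence `2^r ≤
  -- 2^|s|`.
  let ψ : (Fin r → Bool) → (s → Bool) := fun b i => decide ((φ b).1 i = 1)
  have hψ : Function.Injective ψ := by
    intro b b' h
    apply hφ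
    rw [← div_eq_one]
    apply hH
    intro i hi
    have h1 : (φ b).1 i ^ 2 = 1 := congrFun (congrArg Subtype.val (hφ2 b)) i
    have h2 : (φ b').1 i ^ 2 = 1 := congrFun (congrArg Subtype.val (hφ2 b')) i
    have h3 : (φ b).1 i = 1 ↔ (φ b').1 i = 1 := by
      simpa [ψ] using congrFun h ⟨i, hi⟩
    change (φ b).1 i / (φ b').1 i = 1
    rw [div_eq_one]
    by_cases h4 : (φ b).1 i = 1
    · rw [h4, h3.1 h4]
    · exact hG _ _ h1 h2 h4 (fun h5 => h4 (h3.2 h5))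
  have := Fintype.card_le_of_injective ψ hψ
  simpa [Nat.pow_le_pow_iff_right] using this

theorem Circle.eq_of_sq_eq_one (a b : Circle) (ha : a ^ 2 = 1) (hb : b ^ 2 = 1) (ha1 : a ≠ 1)
    (hb1 : b ≠ 1) : a = b := by
  have key (c : Circle) (hc : c ^ 2 = 1) (hc1 : c ≠ 1) : (c : ℂ) = -1 := by
    have h : (c : ℂ) ^ 2 = 1 := by
      rw [← Circle.coe_pow, hc, Circle.coe_one]
    rcases sq_eq_one_iff.1 h with h | h
    · exact absurd (Circle.ext h) hc1
    · exact h
  exact Circle.ext ((key a ha ha1).trans (key b hb hb1).symm)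

end FreeActions

end

theorem corollary1p4 {m : ℕ} (K : PreAbstractSimplicialComplex (Fin m))
    (k : Type u) [Field k] (r : ℕ) :
    (∀ H : Subgroup (Fin m → Circle), Nonempty (H ≃ₜ* (Fin r → Circle)) →
      (∀ (h : H) (z : momentAngle K), h • z = z → h = 1) →
      (2 : Cardinal.{u}) ^ r ≤ totalCohomologyDim k (momentAngle K)) ∧
    (∀ H : Subgroup (Fin m → ℤˣ), Nonempty (H ≃* (Fin r → ℤˣ)) →
      (∀ (h : H) (x : realMomentAngle K), h • x = x → h = 1) →
      (2 : Cardinal.{u}) ^ r ≤ totalCohomologyDim k (realMomentAngle K)) := by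
  obtain ⟨σ, hσ, hmax⟩ := exists_maximal_face K
  have hpow {a b : ℕ} (h : a ≤ b) : (2 : Cardinal.{u}) ^ a ≤ 2 ^ b := by
    exact_mod_cast Nat.pow_le_pow_right (by norm_num) h
  constructor
  · rintro H ⟨e⟩ hfree
    refine (hpow ?_).trans ((two_pow_le_totalHomologyDim_momentAngle k K hσ hmax).trans
      (totalHomologyDim_le k _))
    -- The nontrivial involution of the circle is `-1`, written as `Circle.exp Real.pi`.
    refine le_card_of_injective Circle.eq_of_sq_eq_one (Circle.exp Real.pi) ?_ ?_ σᶜ H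
      e.toMulEquiv fun h hh => eq_one_of_free_momentAngle K hσ H hfree h fun i hi =>
        hh i (Finset.mem_compl.2 hi)
    · rw [← Circle.exp_nsmul]
      simp
    · intro h
      have := congrArg (fun c : Circle => (c : ℂ)) h
      simp [Circle.coe_exp] at this
      norm_num at this
  · rintro H ⟨e⟩ hfree
    refine (hpow ?_).trans ((two_pow_le_totalHomologyDim_realMomentAngle k K hσ hmax).trans
      (totalHomologyDim_le k _))
    refine le_card_of_injective (by decide) (-1) (by decide) (by decide) σᶜ H e fun h hh =>
      eq_one_of_free_realMomentAngle K hσ H hfree h fun i hi => hh i (Finset.mem_compl.2 hi)
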